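/- Let $J$, $T$, $W$, $R$ be finite sets: task types (pickup-delivery pairs), time windows, origin-destination pairs and task bundles. A bundle $r\in R$ is a list of task types, and $\delta_{r,j}$ is the number of times $j$ occurs in $r$. Shippers of group $j\in J$ choose from $\tilde T=T\cup\{0\}$ ($0$: opt out). Drivers of group $(t,w)\in T\times W$ choose from $\tilde R=R\cup\{\emptyset\}$ ($\emptyset$: no task, $\delta_{\emptyset,j}=0$). The groups have $N^S_j$ and $N^D_{(t,w)}$ members, and $N=\sum_j N^S_j+\sum_{t,w}N^D_{(t,w)}$. The perceived costs follow an additive random utility model. The $b$-th shipper of group $j$ has costs $c^b_t=C^S_{j,t}-\zeta^b_{j,t}$ ($t\in\tilde T$), and the $a$-th driver of group $(t,w)$ has costs $c^a_r=C^D_{(t,w),r}-\epsilon^a_{(t,w),r}$ ($r\in\tilde R$). The numbers $C^S_{j,t}$, $C^D_{(t,w),r}$ are deterministic. Within each group the random vectors $(\zeta^b_{j,t})_t$, resp. $(\epsilon^a_{(t,w),r})_r$, $b,a=0,1,2,\dots$, are independent with a common joint law that has finite means. A group of size $n$ consists of the first $n$ agents of its sequence. For $y_j\in\mathbb Z_{\ge0}^{\tilde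 T}$ with $\sum_t y_{j,t}=N^S_j$, let $z^{S\star}_j(y_j)=\min\sum_b\sum_t n^b_tc^b_t$ over $n^b_t\in\{0,1\}$ with $\sum_t n^b_t=1$ for every shipper $b$ and $\sum_b n^b_t=y_{j,t}$ for every $t$. Define $z^{D\star}_{(t,w)}(f_{(t,w)})$ in the same way for drivers. Put $$\Pi^S_j(v)=\mathbb E\Big[\min_{t\in\tilde T}(v_t-\zeta_{j,t})\Big],\qquad \mathcal H^S_j(P)=\inf_{v}\{v\cdot P-\Pi^S_j(v)\},\qquad \hat{\mathcal H}^S_j(y_j)=N^S_j\,\mathcal H^S_j(y_j/N^S_j),$$ and define $\Pi^D_{(t,w)}$, $\mathcal H^D_{(t,w)}$, $\hat{\mathcal H}^D_{(t,w)}$ in the same way from $\epsilon_{(t,w)}$. Consider, for $y,f\ge0$, the constraints $$y_{j,t}\le\sum_{w}\sum_{r\in\tilde R}\delta_{r,j}f_{(t,w),r}\ (j\in J,\,t\in T),\quad \sum_{t\in\tilde T}y_{j,t}=N^S_j,\quad \sum_{r\in\tilde R}f_{(t,w),r}=N^D_{(t,w)}.\qquad(\ast)$$ The master problem [SO/Master]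 is to minimize $Z(y,f)=\sum_jz^{S\star}_j(y_j)+\sum_{t,w}z^{D\star}_{(t,w)}(f_{(t,w)})$ over the integer points $(y,f)$ of $(\ast)$. The problem [SO/Master-A] is to minimize $$Z_A(y,f)=\sum_j\big(C^S_j\cdot y_j-\hat{\mathcal H}^S_j(y_j)\big)+\sum_{t,w}\big(C^D_{(t,w)}\cdot f_{(t,w)}-\hat{\mathcal H}^D_{(t,w)}(f_{(t,w)})\big)$$ over the real points $(y,f)$ of $(\ast)$. Then: 1. The infima that define $\mathcal H^S_j(P)$ and $\mathcal H^D_{(t,w)}(P)$ are finite exactly when $P$ is in the probability simplex. For all group sizes, [SO/Master-A] is a convex problem (convex feasible set, and objective convex on it), and [SO/Master] and [SO/Master-A] both have optimal solutions. 2. When all groups are large, [SO/Master-A] approximates [SO/Master]. Almost surely, for every $\varepsilon>0$ there is $n_0$ such that the following holds whenever all group sizes are at least $n_0$. - (a) $|z^{S\star}_j(y_j)-(C^S_j\cdot y_j-\hat{\mathcal H}^S_j(y_j))|\le\varepsilon N^S_j$ for every $j$ and every $y_j\in\mathbb Z_{\ge0}^{\tilde T}$ with sum $N^S_j$, and $|z^{D\star}_{(t,w)}(f_{(t,w)})-(C^D_{(t,w)}\cdot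 f_{(t,w)}-\hat{\mathcal H}^D_{(t,w)}(f_{(t,w)}))|\le\varepsilon N^D_{(t,w)}$ for every $(t,w)$ and every $f_{(t,w)}\in\mathbb Z_{\ge0}^{\tilde R}$ with sum $N^D_{(t,w)}$. - (b) $|Z-Z_A|\le\varepsilon N$ at every feasible point of [SO/Master]. - (c) For every feasible $(y,f)$ of [SO/Master-A] there is a feasible $(y',f')$ of [SO/Master] with $|y'_{j,t}-y_{j,t}|\le\varepsilon N^S_j$ and $|f'_{(t,w),r}-f_{(t,w),r}|\le\varepsilon N^D_{(t,w)}$ for all indices, and $|Z(y',f')-Z_A(y,f)|\le\varepsilon N$. - (d) The optimal values of the two problems differ by at most $\varepsilon N$, and every optimal solution of [SO/Master] is feasible for [SO/Master-A] with a value $Z_A$ within $\varepsilon N$ of the optimal value. -/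

import Mathlib

open MeasureTheory ProbabilityTheory Filter

namespace CSD

noncomputable section

/-! ### One group of agents facing a finite choice set `A` -/

/-- Feasible points of a sub-problem with agents `0, …, N - 1`: binary choice variables `n b a`,
a single choice for every agent, and prescribed numbers `y a` of agents choosing `a`. -/
def assignments {A : Type*} [Fintype A] (N : ℕ) (y : A → ℕ) : Set (Fin N → A → ℕ) :=
  {n | (∀ b a, n b a = 0 ∨ n b a = 1) ∧ (∀ b, ∑ a, n b a = 1) ∧ ∀ a, ∑ b, n b a = y a}

/-- Total perceived cost of an assignment, where `c b a` is the perceived cost of alternative `a`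
for agent `b`. -/
def subCost {A : Type*} [Fintype A] (c : ℕ → A → ℝ) {N : ℕ} (n : Fin N → A → ℕ) : ℝ :=
  ∑ b, ∑ a, (n b a : ℝ) * c b a

/-- Optimal value of the sub-problem. The set `assignments N y` is finite, and it is nonempty as
soon as `∑ a, y a = N`, so that the infimum is then a minimum. -/
def subValue {A : Type*} [Fintype A] (c : ℕ → A → ℝ) (N : ℕ) (y : A → ℕ) : ℝ :=
  sInf (subCost c '' assignments N y)

/-- Expected minimum cost (negative surplus) `E[min_a (v a - ζ a)]`, for `ζ` with law `μ`. -/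
def surplus {A : Type*} [Fintype A] [Nonempty A] (μ : Measure (A → ℝ)) (v : A → ℝ) : ℝ :=
  ∫ x, Finset.univ.inf' Finset.univ_nonempty (fun a => v a - x a) ∂μ

/-- Perturbation function (generalized entropy): the concave conjugate of `surplus μ`. -/
def entropy {A : Type*} [Fintype A] [Nonempty A] (μ : Measure (A → ℝ)) (P : A → ℝ) : ℝ :=
  ⨅ v : A → ℝ, (∑ a, v a * P a - surplus μ v)

/-- Scaled perturbation function `N * H(y / N)` of a group of size `N`. -/
def scaledEntropy {A : Type*} [Fintype A] [Nonempty A] (μ : Measure (A → ℝ)) (N : ℕ)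
    (y : A → ℝ) : ℝ :=
  N * entropy μ (fun a => y a / N)

/-- Fluid approximation of the optimal value of a sub-problem: deterministic linear cost minus
the scaled perturbation function. -/
def fluidValue {A : Type*} [Fintype A] [Nonempty A] (C : A → ℝ) (μ : Measure (A → ℝ)) (N : ℕ)
    (y : A → ℝ) : ℝ :=
  ∑ a, C a * y a - scaledEntropy μ N y

/-! ### The two-sided market -/

/-- Data of the market: `J` indexes pickup-delivery pairs (shipper groups), `T` time windows,
`W` origin-destination pairs, so that `T × W` indexes driver groups, and `R` task bundles.
The choice set of a shipper is `Option T` and that of a driver is `Option R`, where `none` is the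
opt-out alternative, respectively the empty bundle. -/
structure Market (J T W R : Type*) where
  /-- the list of tasks that make up a bundle -/
  bundle : R → List J
  /-- deterministic costs of shippers -/
  CS : J → Option T → ℝ
  /-- deterministic costs of drivers -/
  CD : T × W → Option R → ℝ
  /-- joint law of the random utilities of a shipper of a group -/
  lawS : J → Measure (Option T → ℝ)
  /-- joint law of the random utilities of a driver of a group -/
  lawD : T × W → Measure (Option R → ℝ)

/-- Group sizes: `N.1 j` shippers in group `j` and `N.2 (t, w)` drivers in group `(t, w)`. -/
abbrev Sizes (J T W : Type*) := (J → ℕ) × (T × W → ℕ)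

/-- A pair `(y, f)`: permits `y j t` and bundle allocations `f (t, w) r`. -/
abbrev Plan (J T W R 𝕜 : Type*) := (J → Option T → 𝕜) × (T × W → Option R → 𝕜)

/-- Total number of agents. -/
def totalSize {J T W : Type*} [Fintype J] [Fintype T] [Fintype W] (N : Sizes J T W) : ℕ :=
  ∑ j, N.1 j + ∑ g, N.2 g

/-- An integer plan seen as a real plan. -/
def Plan.toReal {J T W R : Type*} (x : Plan J T W R ℕ) : Plan J T W R ℝ :=
  (fun j t => (x.1 j t : ℝ), fun g r => (x.2 g r : ℝ))

/-- Number of tasks of type `j` in the bundle `r`. -/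
def Market.delta {J T W R : Type*} [DecidableEq J] (M : Market J T W R) (r : R) (j : J) : ℕ :=
  (M.bundle r).count j

/-- Nonnegative real plans that satisfy the demand-supply constraint and exhaust every group. The
empty bundle contains no task and does not contribute to the supply. -/
def Market.feasible {J T W R : Type*} [DecidableEq J] [Fintype T] [Fintype W] [Fintype R]
    (M : Market J T W R) (N : Sizes J T W) : Set (Plan J T W R ℝ) :=
  {x | (∀ j t, 0 ≤ x.1 j t) ∧ (∀ g r, 0 ≤ x.2 g r) ∧
    (∀ j t, x.1 j (some t) ≤ ∑ w, ∑ r, (M.delta r j : ℝ) * x.2 (t, w) (some r)) ∧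
    (∀ j, ∑ t, x.1 j t = N.1 j) ∧ (∀ g, ∑ r, x.2 g r = N.2 g)}

/-- Feasible points of the master problem: integer plans that satisfy the same constraints. -/
def Market.masterFeasible {J T W R : Type*} [DecidableEq J] [Fintype T] [Fintype W] [Fintype R]
    (M : Market J T W R) (N : Sizes J T W) : Set (Plan J T W R ℕ) :=
  {x | Plan.toReal x ∈ M.feasible N}

/-- Objective of the master problem, for given perceived costs `cS j b t` of shipper `b` of
group `j` and `cD g a r` of driver `a` of group `g`: the sum of the optimal values of the
sub-problems. -/
def masterObj {J T W R : Type*} [Fintype J] [Fintype T] [Fintype W] [Fintype R]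
    (cS : J → ℕ → Option T → ℝ) (cD : T × W → ℕ → Option R → ℝ) (N : Sizes J T W)
    (x : Plan J T W R ℕ) : ℝ :=
  ∑ j, subValue (cS j) (N.1 j) (x.1 j) + ∑ t, ∑ w, subValue (cD (t, w)) (N.2 (t, w)) (x.2 (t, w))

/-- Objective of the approximate master problem. -/
def Market.fluidObj {J T W R : Type*} [Fintype J] [Fintype T] [Fintype W] [Fintype R]
    (M : Market J T W R) (N : Sizes J T W) (x : Plan J T W R ℝ) : ℝ :=
  ∑ j, fluidValue (M.CS j) (M.lawS j) (N.1 j) (x.1 j) +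
    ∑ t, ∑ w, fluidValue (M.CD (t, w)) (M.lawD (t, w)) (N.2 (t, w)) (x.2 (t, w))

/-- `x` solves the problem of minimizing `F` over `S`. -/
def IsOptimal {X : Type*} (F : X → ℝ) (S : Set X) (x : X) : Prop :=
  x ∈ S ∧ ∀ x' ∈ S, F x ≤ F x'

end

end CSD

/-! Each sub-problem is a transportation problem, and its optimal value equals the maximum over
prices `v` of `∑ b, min_a (c b a + v a) - v · y`. Weak duality is a termwise bound; equality with an
integral assignment comes from Hall's marriage theorem, applied at optimal prices to agents and
slots (`exists_subCost_eq_dualObj`). With `c = C - ζ` and `u = C + v`, the dual objective becomes `C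
· y + N (Π_N(u) - u · y / N)`, where `Π_N` is the empirical version of the surplus. Replacing `Π_N`
by `Π` and maximizing over `u` gives exactly `C · y - N H(y / N)`. Hence the error per agent is at
most `sup_u |Π_N(u) - Π(u)|`, whatever `y` is.

This supremum tends to zero almost surely (`ae_eventually_avg_close`). Both functions are
1-Lipschitz in the sup norm and commute with adding a constant, so the smallest price may be taken
to be 0. Truncating prices at a high level `M` then costs only the mean of an integrable tail, and a
finite net handles the remaining compact box.

The entropy is an infimum of affine functions, hence concave. It is continuous on the whole simplex,
boundary included (`continuousOn_entropy`), which gives minimizers by compactness and a modulus of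
continuity per agent independent of the group size. Rounding a real plan to a feasible integer plan
moves entries by a bounded amount (`Market.exists_masterFeasible_close`), negligible in large
groups. -/

namespace CSD

/-! ### Minimum of a finite family of reals -/

section MinCost

variable {A : Type*} [Fintype A] [Nonempty A]

/-- Smallest entry of a finite family of reals. -/
noncomputable def minCost (u : A → ℝ) : ℝ := Finset.univ.inf' Finset.univ_nonempty u

theorem minCost_le (u : A → ℝ) (a : A) : minCost u ≤ u a :=
  Finset.inf'_le _ (Finset.mem_univ a)

theorem le_minCost {u : A → ℝ} {s : ℝ} (h : ∀ a, s ≤ u a) : s ≤ minCost u :=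
  Finset.le_inf' _ _ fun a _ => h a

theorem exists_eq_minCost (u : A → ℝ) : ∃ a, minCost u = u a := by
  obtain ⟨a, -, h⟩ := Finset.exists_mem_eq_inf' (Finset.univ_nonempty (α := A)) u
  exact ⟨a, h⟩

theorem minCost_mono {u w : A → ℝ} (h : ∀ a, u a ≤ w a) : minCost u ≤ minCost w :=
  le_minCost fun a => (minCost_le u a).trans (h a)

theorem minCost_add_const (u : A → ℝ) (s : ℝ) : minCost (fun a => u a + s) = minCost u + s := by
  apply le_antisymm
  · obtain ⟨a, h⟩ := exists_eq_minCost u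
    rw [h]
    exact minCost_le (fun a => u a + s) a
  · exact le_minCost fun a => by linarith [minCost_le u a]

theorem abs_minCost_sub_le {u w : A → ℝ} {δ : ℝ} (h : ∀ a, |u a - w a| ≤ δ) :
    |minCost u - minCost w| ≤ δ := by
  rw [abs_le]
  constructor
  · have : minCost w - δ ≤ minCost u :=
      le_minCost fun a => by linarith [minCost_le w a, (abs_le.1 (h a)).1]
    linarith
  · have : minCost u - δ ≤ minCost w :=
      le_minCost fun a => by linarith [minCost_le u a, (abs_le.1 (h a)).2]
    linarith

theorem continuous_minCost : Continuous (minCost : (A → ℝ) → ℝ) :=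
  Continuous.finset_inf'_apply _ fun a _ => continuous_apply a

theorem abs_minCost_le (u : A → ℝ) : |minCost u| ≤ ∑ a, |u a| := by
  obtain ⟨a, h⟩ := exists_eq_minCost u
  rw [h]
  exact Finset.single_le_sum (f := fun a => |u a|) (fun _ _ => abs_nonneg _) (Finset.mem_univ a)

theorem minCost_le_sum_mul {P : A → ℝ} (hP : P ∈ stdSimplex ℝ A) (u : A → ℝ) :
    minCost u ≤ ∑ a, P a * u a := by
  calc minCost u = ∑ a, P a * minCost u := by rw [← Finset.sum_mul, hP.2, one_mul]
    _ ≤ _ := Finset.sum_le_sum fun a _ => mul_le_mul_of_nonneg_left (minCost_le u a) (hP.1 a)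

end MinCost

/-! ### Surplus and its concave conjugate -/

section Entropy

variable {A : Type*} [Fintype A] [Nonempty A] {μ : Measure (A → ℝ)}

theorem surplus_eq (μ : Measure (A → ℝ)) (v : A → ℝ) :
    surplus μ v = ∫ x, minCost (fun a => v a - x a) ∂μ := rfl

theorem continuous_minCost_sub (v : A → ℝ) :
    Continuous fun x : A → ℝ => minCost (fun a => v a - x a) :=
  continuous_minCost.comp (by fun_prop)

theorem integrable_minCost [IsFiniteMeasure μ] (hμ : ∀ a, Integrable (fun x : A → ℝ => x a) μ)
    (v : A → ℝ) : Integrable (fun x : A → ℝ => minCost (fun a => v a - x a)) μ := by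
  have h : Integrable (fun x : A → ℝ => ∑ a, |v a - x a|) μ :=
    integrable_finsetSum _ fun a _ => ((integrable_const (v a)).sub (hμ a)).abs
  refine h.mono' (continuous_minCost_sub v).measurable.aestronglyMeasurable ?_
  exact ae_of_all _ fun x => abs_minCost_le _

variable [IsProbabilityMeasure μ]

theorem surplus_add_const (hμ : ∀ a, Integrable (fun x : A → ℝ => x a) μ) (v : A → ℝ) (s : ℝ) :
    surplus μ (fun a => v a + s) = surplus μ v + s := by
  have h : ∀ x : A → ℝ, minCost (fun a => v a + s - x a) = minCost (fun a => v a - x a) + s := by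
    intro x
    rw [← minCost_add_const]
    congr 1
    ext a
    ring
  simp only [surplus_eq, h]
  rw [integral_add (integrable_minCost hμ v) (integrable_const s)]
  simp

theorem surplus_mono (hμ : ∀ a, Integrable (fun x : A → ℝ => x a) μ) {v w : A → ℝ}
    (h : ∀ a, v a ≤ w a) : surplus μ v ≤ surplus μ w :=
  integral_mono (integrable_minCost hμ v) (integrable_minCost hμ w) fun _ =>
    minCost_mono fun a => sub_le_sub_right (h a) _

theorem abs_surplus_sub_le (hμ : ∀ a, Integrable (fun x : A → ℝ => x a) μ) {v w : A → ℝ}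
    {δ : ℝ} (h : ∀ a, |v a - w a| ≤ δ) : |surplus μ v - surplus μ w| ≤ δ := by
  rw [surplus_eq, surplus_eq, ← integral_sub (integrable_minCost hμ v) (integrable_minCost hμ w)]
  have := norm_integral_le_of_norm_le_const (μ := μ)
    (f := fun x => minCost (fun a => v a - x a) - minCost (fun a => w a - x a)) (C := δ)
    (ae_of_all _ fun _ => abs_minCost_sub_le fun a => by simpa using h a)
  simpa using this

theorem surplus_le (hμ : ∀ a, Integrable (fun x : A → ℝ => x a) μ) (v : A → ℝ) (a : A) :
    surplus μ v ≤ v a - ∫ x, x a ∂μ := by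
  calc surplus μ v ≤ ∫ x, (v a - x a) ∂μ :=
        integral_mono (integrable_minCost hμ v) ((integrable_const _).sub (hμ a)) fun x =>
          minCost_le _ a
    _ = _ := by rw [integral_sub (integrable_const _) (hμ a)]; simp

/-- Average the bounds `surplus μ v ≤ v a - E[x a]` with weights `S`. The total weight is left free,
so that the bound also covers the small mass by which one distribution exceeds a multiple of
another. -/
theorem sum_mul_integral_le (hμ : ∀ a, Integrable (fun x : A → ℝ => x a) μ) {S : A → ℝ}
    (hS : ∀ a, 0 ≤ S a) (v : A → ℝ) :
    ∑ a, S a * ∫ x, x a ∂μ ≤ ∑ a, v a * S a - (∑ a, S a) * surplus μ v := by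
  rw [Finset.sum_mul, ← Finset.sum_sub_distrib]
  refine Finset.sum_le_sum fun a _ => ?_
  have := mul_le_mul_of_nonneg_left (surplus_le hμ v a) (hS a)
  linarith

theorem bddBelow_conjugate_of_mem (hμ : ∀ a, Integrable (fun x : A → ℝ => x a) μ) {P : A → ℝ}
    (hP : P ∈ stdSimplex ℝ A) :
    BddBelow (Set.range fun v : A → ℝ => ∑ a, v a * P a - surplus μ v) := by
  refine ⟨∑ a, P a * ∫ x, x a ∂μ, ?_⟩
  rintro _ ⟨v, rfl⟩
  have := sum_mul_integral_le hμ hP.1 v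
  rwa [hP.2, one_mul] at this

/-- Necessity tests two kinds of directions: a constant shift moves the surplus by the same
constant, which forces total mass 1, and raising a single price never lowers the surplus, which
forces each coordinate to be nonnegative. -/
theorem bddBelow_conjugate_iff (hμ : ∀ a, Integrable (fun x : A → ℝ => x a) μ) (P : A → ℝ) :
    BddBelow (Set.range fun v : A → ℝ => ∑ a, v a * P a - surplus μ v) ↔
      P ∈ stdSimplex ℝ A := by
  classical
  refine ⟨?_, bddBelow_conjugate_of_mem hμ⟩
  rintro ⟨m, hm⟩
  have hm' : ∀ v : A → ℝ, m ≤ ∑ a, v a * P a - surplus μ v := fun v => hm ⟨v, rfl⟩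
  -- An affine function bounded below on a half-line has nonnegative slope; the chosen `s` would
  -- bring a negative slope to the value `e - (|m| + |e| + 1) < m`.
  have lin : ∀ k e : ℝ, (∀ s : ℝ, 0 ≤ s → m ≤ s * k + e) → 0 ≤ k := by
    intro k e h
    by_contra! hk
    have h1 := h ((|m| + |e| + 1) / (-k)) (by
      have : 0 < -k := by linarith
      positivity)
    have h2 : (|m| + |e| + 1) / (-k) * k = -(|m| + |e| + 1) := by
      rw [div_mul_eq_mul_div, div_eq_iff (by linarith)]
      ring
    linarith [neg_abs_le m, le_abs_self e]
  have hconst : ∀ s : ℝ, m ≤ s * (∑ a, P a - 1) + -surplus μ (fun _ => 0) := by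
    intro s
    have h1 := hm' (fun _ => (0 : ℝ) + s)
    rw [surplus_add_const hμ, ← Finset.mul_sum] at h1
    linarith
  refine ⟨fun a => lin (P a) (-surplus μ fun _ => 0) fun s hs => ?_, ?_⟩
  · have h1 := hm' (Pi.single a s)
    have h2 : surplus μ (fun _ => 0) ≤ surplus μ (Pi.single a s) :=
      surplus_mono hμ fun b => by
        by_cases hb : b = a
        · subst hb; simpa using hs
        · simp [hb]
    have h3 : ∑ b, (Pi.single a s : A → ℝ) b * P b = s * P a := by
      simp [Pi.single_apply]
    linarith
  · have h1 := lin (∑ a, P a - 1) _ fun s _ => hconst s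
    have h2 := lin (-(∑ a, P a - 1)) (-surplus μ fun _ => 0) fun s _ => by
      linarith [hconst (-s)]
    linarith

theorem entropy_le (hμ : ∀ a, Integrable (fun x : A → ℝ => x a) μ) {P : A → ℝ}
    (hP : P ∈ stdSimplex ℝ A) (v : A → ℝ) : entropy μ P ≤ ∑ a, v a * P a - surplus μ v :=
  ciInf_le (bddBelow_conjugate_of_mem hμ hP) v

theorem concaveOn_entropy (hμ : ∀ a, Integrable (fun x : A → ℝ => x a) μ) :
    ConcaveOn ℝ (stdSimplex ℝ A) (entropy μ) := by
  refine ⟨convex_stdSimplex ℝ A, ?_⟩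
  intro P hP Q hQ s t hs ht hst
  refine le_ciInf fun v => ?_
  have h1 := mul_le_mul_of_nonneg_left (entropy_le hμ hP v) hs
  have h2 := mul_le_mul_of_nonneg_left (entropy_le hμ hQ v) ht
  have h3 : ∑ a, v a * (s • P + t • Q) a = s * ∑ a, v a * P a + t * ∑ a, v a * Q a := by
    rw [Finset.mul_sum, Finset.mul_sum, ← Finset.sum_add_distrib]
    refine Finset.sum_congr rfl fun a _ => ?_
    simp only [Pi.add_apply, Pi.smul_apply, smul_eq_mul]
    ring
  rw [h3]
  simp only [smul_eq_mul]
  have h4 : surplus μ v = s * surplus μ v + t * surplus μ v := by rw [← add_mul, hst, one_mul]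
  linarith

/-- Moving a fraction `l` of the mass changes the entropy by a controlled amount. -/
theorem le_entropy_of_le (hμ : ∀ a, Integrable (fun x : A → ℝ => x a) μ) {P Q : A → ℝ}
    (hP : P ∈ stdSimplex ℝ A) (hQ : Q ∈ stdSimplex ℝ A) {l : ℝ} (hl : l ≤ 1)
    (h : ∀ a, (1 - l) * Q a ≤ P a) :
    (1 - l) * entropy μ Q - l * ∑ a, |∫ x, x a ∂μ| ≤ entropy μ P := by
  refine le_ciInf fun v => ?_
  have h1 := mul_le_mul_of_nonneg_left (entropy_le hμ hQ v) (sub_nonneg.2 hl)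
  -- The residual `P - (1 - l) Q` is nonnegative of total mass `l`, so its contribution is bounded
  -- below by the means alone, uniformly in `v`.
  have hS : ∀ a, 0 ≤ P a - (1 - l) * Q a := fun a => sub_nonneg.2 (h a)
  have h2 := sum_mul_integral_le hμ hS v
  have h3 : ∑ a, (P a - (1 - l) * Q a) = l := by
    rw [Finset.sum_sub_distrib, ← Finset.mul_sum, hP.2, hQ.2]; ring
  have h4 : ∑ a, v a * (P a - (1 - l) * Q a)
      = ∑ a, v a * P a - (1 - l) * ∑ a, v a * Q a := by
    rw [Finset.mul_sum, ← Finset.sum_sub_distrib]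
    exact Finset.sum_congr rfl fun a _ => by ring
  have h5 : -(l * ∑ a, |∫ x, x a ∂μ|) ≤ ∑ a, (P a - (1 - l) * Q a) * ∫ x, x a ∂μ := by
    have h9 : -(l * ∑ a, |∫ x, x a ∂μ|)
        = ∑ a, -((P a - (1 - l) * Q a) * ∑ b, |∫ x, x b ∂μ|) := by
      rw [Finset.sum_neg_distrib, ← Finset.sum_mul, h3]
    rw [h9]
    refine Finset.sum_le_sum fun a _ => ?_
    have h6 : |∫ x, x a ∂μ| ≤ ∑ b, |∫ x, x b ∂μ| :=
      Finset.single_le_sum (f := fun b => |∫ x, x b ∂μ|) (fun _ _ => abs_nonneg _)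
        (Finset.mem_univ a)
    have h7 := mul_le_mul_of_nonneg_left h6 (hS a)
    have h8 := mul_le_mul_of_nonneg_left (neg_abs_le (∫ x, x a ∂μ)) (hS a)
    linarith
  rw [h3, h4] at h2
  linarith

/-- Upper semicontinuity is automatic for an infimum of continuous functions. Lower semicontinuity,
also at boundary points, holds because `P` near `Q` dominates `(1 - l) Q` with `l` tending to 0. -/
theorem continuousOn_entropy (hμ : ∀ a, Integrable (fun x : A → ℝ => x a) μ) :
    ContinuousOn (entropy μ) (stdSimplex ℝ A) := by
  intro Q hQ
  -- `1 - l P` is the largest factor in `[0, 1]` by which `Q` can be scaled and stay below `P`;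
  -- coordinates with `Q a = 0` impose nothing and get the neutral value 1.
  let l : (A → ℝ) → ℝ := fun P => 1 - minCost fun a => if Q a = 0 then 1 else min 1 (P a / Q a)
  have hlc : Continuous l := by
    refine continuous_const.sub (continuous_minCost.comp (continuous_pi fun a => ?_))
    by_cases ha : Q a = 0
    · simp only [ha, if_true]; exact continuous_const
    · simp only [ha, if_false]; fun_prop
  have hlQ : l Q = 0 := by
    have : (fun a => if Q a = 0 then (1 : ℝ) else min 1 (Q a / Q a)) = fun _ => 1 := by
      ext a
      by_cases ha : Q a = 0 <;> simp [ha]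
    simp only [l, this]
    obtain ⟨a, ha⟩ := exists_eq_minCost (fun _ : A => (1 : ℝ))
    rw [ha]; ring
  have hlow : Tendsto (fun P => (1 - l P) * entropy μ Q - l P * ∑ a, |∫ x, x a ∂μ|)
      (nhdsWithin Q (stdSimplex ℝ A)) (nhds (entropy μ Q)) := by
    have h1 : Continuous fun P => (1 - l P) * entropy μ Q - l P * ∑ a, |∫ x, x a ∂μ| := by
      fun_prop
    have h2 := (h1.tendsto Q).mono_left (nhdsWithin_le_nhds (s := stdSimplex ℝ A))
    simpa [hlQ] using h2
  refine tendsto_order.2 ⟨fun e he => ?_, fun e he => ?_⟩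
  · filter_upwards [(tendsto_order.1 hlow).1 e he, self_mem_nhdsWithin] with P h1 hP
    refine h1.trans_le (le_entropy_of_le hμ hP hQ ?_ fun a => ?_)
    · have : 0 ≤ minCost fun a => if Q a = 0 then (1 : ℝ) else min 1 (P a / Q a) :=
        le_minCost fun a => by
          split_ifs
          · exact zero_le_one
          · exact le_min zero_le_one (div_nonneg (hP.1 a) (hQ.1 a))
      simp only [l]; linarith
    · by_cases ha : Q a = 0
      · rw [ha, mul_zero]; exact hP.1 a
      · have h2 := minCost_le (fun a => if Q a = 0 then (1 : ℝ) else min 1 (P a / Q a)) a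
        simp only [ha, if_false] at h2
        have h3 : 1 - l P ≤ P a / Q a := by
          simp only [l, sub_sub_cancel]
          exact h2.trans (min_le_right _ _)
        exact (le_div_iff₀ (lt_of_le_of_ne (hQ.1 a) (Ne.symm ha))).1 h3
  · obtain ⟨v, hv⟩ := exists_lt_of_ciInf_lt he
    have h1 : Continuous fun P : A → ℝ => ∑ a, v a * P a - surplus μ v := by fun_prop
    have h2 := (h1.tendsto Q).mono_left (nhdsWithin_le_nhds (s := stdSimplex ℝ A))
    filter_upwards [(tendsto_order.1 h2).2 e hv, self_mem_nhdsWithin] with P h3 hP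
    exact (entropy_le hμ hP v).trans_lt h3

end Entropy

/-! ### Transportation duality with integral optima -/

section Duality

variable {A : Type*} [Fintype A] [Nonempty A]

/-- Dual objective of a sub-problem, with prices `v`. -/
noncomputable def dualObj (c : ℕ → A → ℝ) (N : ℕ) (y : A → ℕ) (v : A → ℝ) : ℝ :=
  ∑ b : Fin N, minCost (fun a => c b a + v a) - ∑ a, v a * y a

theorem dualObj_le_subCost (c : ℕ → A → ℝ) {N : ℕ} {y : A → ℕ} {n : Fin N → A → ℕ}
    (hn : n ∈ assignments N y) (v : A → ℝ) : dualObj c N y v ≤ subCost c n := by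
  have h1 : ∑ a, v a * (y a : ℝ) = ∑ b : Fin N, ∑ a, (n b a : ℝ) * v a := by
    rw [Finset.sum_comm]
    refine Finset.sum_congr rfl fun a _ => ?_
    rw [← hn.2.2 a, ← Finset.sum_mul]
    push_cast
    ring
  rw [dualObj, h1, subCost, sub_le_iff_le_add, ← Finset.sum_add_distrib]
  refine Finset.sum_le_sum fun b _ => ?_
  have hb : (fun a => (n b a : ℝ)) ∈ stdSimplex ℝ A :=
    ⟨fun a => Nat.cast_nonneg _, by
      have h := hn.2.1 b
      change ∑ a, (n b a : ℝ) = 1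
      exact_mod_cast h⟩
  refine (minCost_le_sum_mul hb _).trans_eq ?_
  rw [← Finset.sum_add_distrib]
  exact Finset.sum_congr rfl fun a _ => by ring

theorem dualObj_add_const (c : ℕ → A → ℝ) {N : ℕ} {y : A → ℕ} (hy : ∑ a, y a = N) (v : A → ℝ)
    (s : ℝ) : dualObj c N y (fun a => v a + s) = dualObj c N y v := by
  have h1 : ∀ b : Fin N, minCost (fun a => c b a + (v a + s))
      = minCost (fun a => c b a + v a) + s := by
    intro b
    rw [← minCost_add_const]
    congr 1
    ext a
    ring
  have h2 : ∑ a, (y a : ℝ) = N := by exact_mod_cast hy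
  simp only [dualObj, h1, add_mul, Finset.sum_add_distrib, ← Finset.mul_sum, h2]
  simp
  ring

/-- Shift invariance allows the smallest price to be 0. Prices above `2 * K` can then be cut to `2 *
K` without lowering the objective, so a maximum over a compact box is global. -/
theorem exists_dualObj_max (c : ℕ → A → ℝ) {N : ℕ} {y : A → ℕ} (hy : ∑ a, y a = N) :
    ∃ v, ∀ w, dualObj c N y w ≤ dualObj c N y v := by
  let K : ℝ := ∑ b : Fin N, ∑ a, |c b a|
  have hK : ∀ (b : Fin N) a, |c b a| ≤ K := fun b a =>
    (Finset.single_le_sum (f := fun a => |c b a|) (fun _ _ => abs_nonneg _)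
      (Finset.mem_univ a)).trans
      (Finset.single_le_sum (f := fun b : Fin N => ∑ a, |c b a|)
        (fun _ _ => Finset.sum_nonneg fun _ _ => abs_nonneg _) (Finset.mem_univ b))
  have hK0 : 0 ≤ K := Finset.sum_nonneg fun _ _ => Finset.sum_nonneg fun _ _ => abs_nonneg _
  have hcont : Continuous (dualObj c N y) := by
    refine Continuous.sub (continuous_finsetSum _ fun b _ => ?_) (by fun_prop)
    exact continuous_minCost.comp (by fun_prop)
  obtain ⟨v, -, hv⟩ := (isCompact_Icc (a := (0 : A → ℝ)) (b := fun _ => 2 * K)).exists_isMaxOn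
    ⟨0, le_rfl, fun _ => by simpa using hK0⟩ hcont.continuousOn
  refine ⟨v, fun w => ?_⟩
  have hm : ∀ a, 0 ≤ w a + -minCost w := fun a => by linarith [minCost_le w a]
  rw [← dualObj_add_const c hy w (-minCost w)]
  refine le_trans ?_ (hv (show (fun a => min (w a + -minCost w) (2 * K)) ∈ _ from
    ⟨fun a => le_min (hm a) (by simpa using hK0), fun a => min_le_right _ _⟩))
  refine sub_le_sub (Finset.sum_le_sum fun b _ => le_minCost fun a => ?_)
    (Finset.sum_le_sum fun a _ => mul_le_mul_of_nonneg_right (min_le_left _ _) (Nat.cast_nonneg _))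
  change minCost (fun a => c b a + (w a + -minCost w)) ≤ c b a + min (w a + -minCost w) (2 * K)
  rcases le_total (w a + -minCost w) (2 * K) with h | h
  · rw [min_eq_left h]
    exact minCost_le (fun a => c b a + (w a + -minCost w)) a
  · rw [min_eq_right h]
    -- The alternative of price 0 costs at most `K`, while one of price `2 * K` costs at least `K`.
    obtain ⟨a₀, h₀⟩ := exists_eq_minCost w
    have h1 := minCost_le (fun a => c b a + (w a + -minCost w)) a₀
    simp only [← h₀] at h1
    linarith [le_abs_self (c b a₀), neg_abs_le (c b a), hK b a, hK b a₀]

/-- At optimal prices every set of agents finds enough room among its cheapest alternatives. -/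
theorem card_le_of_dualObj_max (c : ℕ → A → ℝ) {N : ℕ} {y : A → ℕ} {v : A → ℝ}
    (hv : ∀ w, dualObj c N y w ≤ dualObj c N y v) (B : Finset (Fin N)) (U : Finset A)
    (hU : ∀ b ∈ B, ∀ a, c b a + v a = minCost (fun a => c b a + v a) → a ∈ U) :
    B.card ≤ ∑ a ∈ U, y a := by
  classical
  by_contra! hlt
  -- Raise the prices on `U` by a `δ` below every positive gap to the minimum: each agent of `B`
  -- then contributes `δ` more and no other agent contributes less, while the linear term loses `δ *
  -- ∑ a ∈ U, y a`. If `B` were larger than this capacity, the objective would increase.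
  have hδ : ∀ᶠ δ : ℝ in nhdsWithin 0 (Set.Ioi 0), ∀ (b : Fin N) a,
      c b a + v a ≠ minCost (fun a => c b a + v a) →
        minCost (fun a => c b a + v a) + δ ≤ c b a + v a := by
    rw [eventually_all]; intro b
    rw [eventually_all]; intro a
    by_cases h : c b a + v a = minCost (fun a => c b a + v a)
    · exact Eventually.of_forall fun _ h' => absurd h h'
    · have hpos : 0 < c b a + v a - minCost (fun a => c b a + v a) :=
        sub_pos.2 (lt_of_le_of_ne (minCost_le (fun a => c b a + v a) a) (Ne.symm h))
      filter_upwards [nhdsWithin_le_nhds (Iio_mem_nhds hpos)] with δ hδ _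
      have : δ < _ := hδ
      linarith
  obtain ⟨δ, hδ, hδ0⟩ := (hδ.and self_mem_nhdsWithin).exists
  have hδ0 : 0 < δ := hδ0
  have h1 := hv fun a => v a + if a ∈ U then δ else 0
  have h2 : ∀ b : Fin N, minCost (fun a => c b a + v a) + (if b ∈ B then δ else 0) ≤
      minCost (fun a => c b a + (v a + if a ∈ U then δ else 0)) := by
    intro b
    refine le_minCost fun a => ?_
    have h3 := minCost_le (fun a => c b a + v a) a
    by_cases hb : b ∈ B
    · by_cases ha : a ∈ U
      · simp only [hb, ha, if_true]; linarith
      · simp only [hb, ha, if_true, if_false]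
        have := hδ b a fun h => ha (hU b hb a h)
        linarith
    · simp only [hb, if_false]
      split_ifs <;> linarith
  have h3 := Finset.sum_le_sum fun (b : Fin N) (_ : b ∈ Finset.univ) => h2 b
  have h4 : ∑ b : Fin N, (if b ∈ B then δ else 0) = B.card * δ := by simp
  have h5 : ∑ a, (if a ∈ U then δ else 0) * (y a : ℝ) = δ * ∑ a ∈ U, (y a : ℝ) := by
    simp [ite_mul, Finset.mul_sum]
  rw [Finset.sum_add_distrib, h4] at h3
  simp only [dualObj, add_mul, Finset.sum_add_distrib, h5] at h1
  have h6 : ∑ a ∈ U, (y a : ℝ) < B.card := by exact_mod_cast hlt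
  have h7 := mul_lt_mul_of_pos_left h6 hδ0
  linarith

/-- Strong duality for the sub-problems, with integral primal solutions. -/
theorem exists_subCost_eq_dualObj (c : ℕ → A → ℝ) {N : ℕ} {y : A → ℕ} (hy : ∑ a, y a = N) :
    ∃ v, ∃ n ∈ assignments N y, subCost c n = dualObj c N y v := by
  classical
  obtain ⟨v, hv⟩ := exists_dualObj_max c hy
  -- Alternative `a` is split into `y a` slots; an agent accepts the slots of its cheapest
  -- alternatives.
  let t : Fin N → Finset (Σ a, Fin (y a)) := fun b =>
    Finset.univ.filter fun s => c b s.1 + v s.1 = minCost (fun a => c b a + v a)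
  have hall : ∀ B : Finset (Fin N), B.card ≤ (B.biUnion t).card := by
    intro B
    let U : Finset A := Finset.univ.filter fun a =>
      ∃ b ∈ B, c b a + v a = minCost (fun a => c b a + v a)
    have h1 : B.biUnion t = U.sigma fun a => (Finset.univ : Finset (Fin (y a))) := by
      ext s
      simp [t, U]
    rw [h1, Finset.card_sigma]
    simp only [Finset.card_univ, Fintype.card_fin]
    exact card_le_of_dualObj_max c hv B U fun b hb a h => by
      simp only [U, Finset.mem_filter, Finset.mem_univ, true_and]
      exact ⟨b, hb, h⟩
  obtain ⟨f, hfi, hft⟩ := (Finset.all_card_le_biUnion_card_iff_exists_injective t).1 hall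
  -- There are exactly `N` slots, so an injective matching fills them all and meets every quota.
  have hf : Function.Bijective f :=
    (Fintype.bijective_iff_injective_and_card f).2 ⟨hfi, by simp [hy]⟩
  have hft' : ∀ b : Fin N, c b (f b).1 + v (f b).1 = minCost (fun a => c b a + v a) := fun b => by
    simpa [t] using hft b
  refine ⟨v, fun b a => if (f b).1 = a then 1 else 0, ⟨fun b a => ?_, fun b => ?_, fun a => ?_⟩, ?_⟩
  · by_cases h : (f b).1 = a <;> simp [h]
  · simp
  · refine ((Equiv.ofBijective f hf).sum_comp fun s => if s.1 = a then 1 else 0).trans ?_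
    rw [Fintype.sum_sigma, Finset.sum_eq_single a (fun a' _ h => by simp [h]) (by simp)]
    simp
  · have h1 : ∑ b, v (f b).1 = ∑ a, v a * (y a : ℝ) := by
      refine ((Equiv.ofBijective f hf).sum_comp fun s => v s.1).trans ?_
      rw [Fintype.sum_sigma]
      simp [mul_comm]
    have h2 : subCost c (fun b a => if (f b).1 = a then 1 else 0) = ∑ b : Fin N, c b (f b).1 := by
      simp [subCost]
    rw [h2, dualObj, ← h1, ← Finset.sum_sub_distrib]
    exact Finset.sum_congr rfl fun b _ => by linarith [hft' b]

theorem dualObj_le_subValue (c : ℕ → A → ℝ) {N : ℕ} {y : A → ℕ} (hy : ∑ a, y a = N)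
    (v : A → ℝ) : dualObj c N y v ≤ subValue c N y := by
  obtain ⟨-, n, hn, -⟩ := exists_subCost_eq_dualObj c hy
  refine le_csInf ⟨_, n, hn, rfl⟩ ?_
  rintro _ ⟨n', hn', rfl⟩
  exact dualObj_le_subCost c hn' v

theorem exists_subValue_eq_dualObj (c : ℕ → A → ℝ) {N : ℕ} {y : A → ℕ} (hy : ∑ a, y a = N) :
    ∃ v, subValue c N y = dualObj c N y v := by
  obtain ⟨v, n, hn, h⟩ := exists_subCost_eq_dualObj c hy
  refine ⟨v, le_antisymm ?_ (dualObj_le_subValue c hy v)⟩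
  rw [← h]
  refine csInf_le ⟨dualObj c N y v, ?_⟩ ⟨n, hn, rfl⟩
  rintro _ ⟨n', hn', rfl⟩
  exact dualObj_le_subCost c hn' v

end Duality

/-! ### Law of large numbers, uniform over prices -/

section UniformLaw

variable {A : Type*} [Fintype A] [Nonempty A] {μ : Measure (A → ℝ)}

/-- Excess of the oscillation of the random utilities over the level `M`. -/
def excess (M : ℝ) (x : A → ℝ) : ℝ := max (2 * ‖x‖ - M) 0

omit [Nonempty A] in
theorem continuous_excess (M : ℝ) : Continuous (excess M : (A → ℝ) → ℝ) := by
  unfold excess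
  fun_prop

omit [Nonempty A] in
theorem integrable_norm_pi (hμ : ∀ a, Integrable (fun x : A → ℝ => x a) μ) :
    Integrable (fun x : A → ℝ => ‖x‖) μ := by
  refine (integrable_finsetSum Finset.univ fun a _ => (hμ a).abs).mono'
    continuous_norm.measurable.aestronglyMeasurable (ae_of_all _ fun x => ?_)
  rw [norm_norm]
  refine (pi_norm_le_iff_of_nonneg (Finset.sum_nonneg fun _ _ => abs_nonneg _)).2 fun a => ?_
  exact Finset.single_le_sum (f := fun a => |x a|) (fun _ _ => abs_nonneg _) (Finset.mem_univ a)

omit [Nonempty A] in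
theorem norm_excess_le {M : ℝ} (hM : 0 ≤ M) (x : A → ℝ) : ‖excess M x‖ ≤ 2 * ‖x‖ := by
  rw [excess, Real.norm_eq_abs, abs_of_nonneg (le_max_right _ _)]
  exact max_le (by linarith) (by positivity)

omit [Nonempty A] in
theorem integrable_excess (hμ : ∀ a, Integrable (fun x : A → ℝ => x a) μ) {M : ℝ} (hM : 0 ≤ M) :
    Integrable (excess M : (A → ℝ) → ℝ) μ :=
  ((integrable_norm_pi hμ).const_mul 2).mono' (continuous_excess M).measurable.aestronglyMeasurable
    (ae_of_all _ (norm_excess_le hM))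

omit [Nonempty A] in
theorem tendsto_integral_excess (hμ : ∀ a, Integrable (fun x : A → ℝ => x a) μ) :
    Tendsto (fun M : ℕ => ∫ x, excess (M : ℝ) x ∂μ) atTop (nhds 0) := by
  rw [← integral_zero (A → ℝ) ℝ (μ := μ)]
  refine tendsto_integral_of_dominated_convergence (fun x => 2 * ‖x‖)
    (fun M => (continuous_excess _).measurable.aestronglyMeasurable)
    ((integrable_norm_pi hμ).const_mul 2)
    (fun M => ae_of_all _ (norm_excess_le (Nat.cast_nonneg M))) (ae_of_all _ fun x => ?_)
  obtain ⟨k, hk⟩ := exists_nat_ge (2 * ‖x‖)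
  refine tendsto_const_nhds.congr' ?_
  filter_upwards [eventually_ge_atTop k] with M hM
  have : (k : ℝ) ≤ M := by exact_mod_cast hM
  exact (max_eq_right (by linarith)).symm

theorem minCost_min_le (v x : A → ℝ) (M : ℝ) :
    minCost (fun a => min (v a) M - x a) ≤ minCost (fun a => v a - x a) :=
  minCost_mono fun _ => sub_le_sub_right (min_le_left _ _) _

/-- Truncating the prices at a level `M` above the smallest one matters only for agents with
large random utilities. -/
theorem minCost_le_min_add_excess {v : A → ℝ} {a₀ : A} (h₀ : v a₀ = 0) (x : A → ℝ) (M : ℝ) :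
    minCost (fun a => v a - x a) ≤ minCost (fun a => min (v a) M - x a) + excess M x := by
  obtain ⟨a, ha⟩ := exists_eq_minCost fun a => min (v a) M - x a
  rw [ha]
  rcases le_total (v a) M with h | h
  · rw [min_eq_left h]
    have := le_max_right (2 * ‖x‖ - M) 0
    have h1 := minCost_le (fun a => v a - x a) a
    simp only [excess]
    linarith
  · rw [min_eq_right h]
    -- Switching to `a₀` costs `-x a₀ ≤ ‖x‖`, against at least `M - ‖x‖` at the truncated price;
    -- hence the excess `2 * ‖x‖ - M`.
    have h1 := minCost_le (fun a => v a - x a) a₀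
    have h2 := le_max_left (2 * ‖x‖ - M) 0
    have h3 := (abs_le.1 (norm_le_pi_norm x a)).2
    have h4 := (abs_le.1 (norm_le_pi_norm x a₀)).1
    simp only [h₀] at h1
    simp only [excess]
    linarith

/-- Average of a function over the first `n` terms of a sequence. -/
noncomputable def avg {X : Type*} (x : ℕ → X) (n : ℕ) (g : X → ℝ) : ℝ :=
  (∑ b ∈ Finset.range n, g (x b)) / n

theorem avg_mono {X : Type*} (x : ℕ → X) (n : ℕ) {g h : X → ℝ} (hgh : ∀ z, g z ≤ h z) :
    avg x n g ≤ avg x n h :=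
  div_le_div_of_nonneg_right (Finset.sum_le_sum fun _ _ => hgh _) (Nat.cast_nonneg n)

theorem avg_add {X : Type*} (x : ℕ → X) (n : ℕ) (g h : X → ℝ) :
    avg x n (fun z => g z + h z) = avg x n g + avg x n h := by
  simp only [avg, Finset.sum_add_distrib, add_div]

theorem avg_add_const {X : Type*} (x : ℕ → X) {n : ℕ} (hn : n ≠ 0) (g : X → ℝ) (s : ℝ) :
    avg x n (fun z => g z + s) = avg x n g + s := by
  have : (n : ℝ) ≠ 0 := by exact_mod_cast hn
  rw [avg_add]
  simp only [avg, Finset.sum_const, Finset.card_range, nsmul_eq_mul]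
  field_simp

theorem ae_tendsto_avg {Ω X : Type*} [MeasurableSpace Ω] {Pr : Measure Ω} [MeasurableSpace X]
    {ν : Measure X} {ζ : ℕ → Ω → X} (hlaw : ∀ b, HasLaw (ζ b) ν Pr) (hind : iIndepFun ζ Pr)
    {g : X → ℝ} (hg : Measurable g) (hint : Integrable g ν) :
    ∀ᵐ ω ∂Pr, Tendsto (fun n => avg (fun b => ζ b ω) n g) atTop (nhds (∫ x, g x ∂ν)) := by
  have hid : ∀ i, IdentDistrib (fun ω => g (ζ i ω)) (fun ω => g (ζ 0 ω)) Pr Pr := fun i =>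
    IdentDistrib.comp ⟨(hlaw i).aemeasurable, (hlaw 0).aemeasurable,
      (hlaw i).map_eq.trans (hlaw 0).map_eq.symm⟩ hg
  have hint' : Integrable (fun ω => g (ζ 0 ω)) Pr := by
    refine Integrable.comp_aemeasurable (f := ζ 0) (g := g) ?_ (hlaw 0).aemeasurable
    rwa [(hlaw 0).map_eq]
  have h := strong_law_ae_real (fun b ω => g (ζ b ω)) hint'
    (fun i j hij => (hind.indepFun hij).comp hg hg) hid
  have hmean : ∫ ω, g (ζ 0 ω) ∂Pr = ∫ x, g x ∂ν :=
    (hlaw 0).integral_comp hg.aestronglyMeasurable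
  rw [hmean] at h
  exact h

variable [IsProbabilityMeasure μ]

theorem abs_avg_minCost_sub_le (x : ℕ → A → ℝ) (n : ℕ) {v w : A → ℝ} {δ : ℝ} (hδ : 0 ≤ δ)
    (h : ∀ a, |v a - w a| ≤ δ) :
    |avg x n (fun z => minCost fun a => v a - z a) -
      avg x n (fun z => minCost fun a => w a - z a)| ≤ δ := by
  rcases eq_or_ne n 0 with rfl | hn
  · simpa [avg] using hδ
  have key : ∀ v w : A → ℝ, (∀ a, |v a - w a| ≤ δ) →
      avg x n (fun z => minCost fun a => v a - z a) ≤
        avg x n (fun z => minCost fun a => w a - z a) + δ := by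
    intro v w h
    rw [← avg_add_const x hn]
    refine avg_mono x n fun z => ?_
    have := abs_minCost_sub_le (u := fun a => v a - z a) (w := fun a => w a - z a) (δ := δ)
      fun a => by simpa using h a
    linarith [(abs_le.1 this).2]
  have h1 := key v w h
  have h2 := key w v fun a => by rw [abs_sub_comm]; exact h a
  rw [abs_le]
  constructor <;> linarith

/-- A sample that obeys the law of large numbers at a dense set of prices, and for the excesses,
obeys it uniformly over all prices. -/
theorem eventually_avg_close (hμ : ∀ a, Integrable (fun x : A → ℝ => x a) μ) (x : ℕ → A → ℝ)
    (hq : ∀ k, Tendsto (fun n => avg x n fun z =>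
      minCost fun a => TopologicalSpace.denseSeq (A → ℝ) k a - z a) atTop
      (nhds (surplus μ (TopologicalSpace.denseSeq (A → ℝ) k))))
    (hM : ∀ M : ℕ, Tendsto (fun n => avg x n (excess (M : ℝ))) atTop
      (nhds (∫ z, excess (M : ℝ) z ∂μ))) {ε : ℝ} (hε : 0 < ε) :
    ∀ᶠ n in atTop, ∀ v : A → ℝ,
      |avg x n (fun z => minCost fun a => v a - z a) - surplus μ v| ≤ ε := by
  -- Error budget: at most `ε / 4` for truncation, and `ε / 8` each for moving to the net in the
  -- sample, the sample error on the net, and moving back in the surplus.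
  obtain ⟨M, hMε⟩ := ((tendsto_order.1 (tendsto_integral_excess hμ)).2 (ε / 8)
    (by positivity)).exists
  obtain ⟨s, hs⟩ := (isCompact_Icc (a := (0 : A → ℝ)) (b := fun _ => (M : ℝ))).elim_finite_subcover
    (fun k => Metric.ball (TopologicalSpace.denseSeq (A → ℝ) k) (ε / 8))
    (fun k => Metric.isOpen_ball) (fun v _ => by
      obtain ⟨k, hk⟩ := (TopologicalSpace.denseRange_denseSeq (A → ℝ)).exists_dist_lt v
        (show 0 < ε / 8 by positivity)
      exact Set.mem_iUnion.2 ⟨k, hk⟩)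
  have hfin : ∀ᶠ n in atTop, ∀ k ∈ s, |avg x n (fun z =>
      minCost fun a => TopologicalSpace.denseSeq (A → ℝ) k a - z a) -
        surplus μ (TopologicalSpace.denseSeq (A → ℝ) k)| ≤ ε / 8 := by
    rw [Finset.eventually_all]
    intro k _
    filter_upwards [Metric.tendsto_nhds.1 (hq k) (ε / 8) (by positivity)] with n hn
    exact hn.le
  filter_upwards [hfin, (tendsto_order.1 (hM M)).2 (ε / 4) (by linarith), eventually_ne_atTop 0]
    with n h1 h2 hn
  have normalized : ∀ v : A → ℝ, (∀ a, 0 ≤ v a) → (∃ a, v a = 0) →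
      |avg x n (fun z => minCost fun a => v a - z a) - surplus μ v| ≤ ε := by
    rintro v hv ⟨a₀, h₀⟩
    set w : A → ℝ := fun a => min (v a) M with hw
    have hwmem : w ∈ Set.Icc (0 : A → ℝ) fun _ => (M : ℝ) :=
      ⟨fun a => le_min (hv a) (Nat.cast_nonneg M), fun a => min_le_right _ _⟩
    obtain ⟨k, hk, hkw⟩ := Set.mem_iUnion₂.1 (hs hwmem)
    have hqw : ∀ a, |w a - TopologicalSpace.denseSeq (A → ℝ) k a| ≤ ε / 8 := fun a =>
      (dist_le_pi_dist w (TopologicalSpace.denseSeq (A → ℝ) k) a).trans hkw.le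
    have h3 := abs_avg_minCost_sub_le x n (by positivity) hqw
    have h4 := abs_surplus_sub_le hμ hqw
    have h5 := h1 k hk
    have h6 : avg x n (fun z => minCost fun a => w a - z a) ≤
        avg x n (fun z => minCost fun a => v a - z a) :=
      avg_mono x n fun z => minCost_min_le v z M
    have h7 : avg x n (fun z => minCost fun a => v a - z a) ≤
        avg x n (fun z => minCost fun a => w a - z a) + avg x n (excess (M : ℝ)) := by
      rw [← avg_add]
      exact avg_mono x n fun z => minCost_le_min_add_excess h₀ z M
    have h8 : surplus μ w ≤ surplus μ v := surplus_mono hμ fun a => min_le_left _ _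
    have h9 : surplus μ v ≤ surplus μ w + ∫ z, excess (M : ℝ) z ∂μ := by
      rw [surplus_eq, surplus_eq, ← integral_add (integrable_minCost hμ w)
        (integrable_excess hμ (Nat.cast_nonneg M))]
      exact integral_mono (integrable_minCost hμ v) ((integrable_minCost hμ w).add
        (integrable_excess hμ (Nat.cast_nonneg M))) fun z => minCost_le_min_add_excess h₀ z M
    rw [abs_le] at *
    constructor <;> linarith [h3.1, h3.2, h4.1, h4.2, h5.1, h5.2]
  intro v
  have h3 := normalized (fun a => v a + -minCost v) (fun a => by linarith [minCost_le v a])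
    (by obtain ⟨a, ha⟩ := exists_eq_minCost v; exact ⟨a, by linarith⟩)
  have h4 : avg x n (fun z => minCost fun a => v a + -minCost v - z a) =
      avg x n (fun z => minCost fun a => v a - z a) + -minCost v := by
    rw [← avg_add_const x hn]
    congr 1
    ext z
    rw [← minCost_add_const]
    congr 1
    ext a
    ring
  rw [h4, surplus_add_const hμ] at h3
  simpa using h3

/-- Only countably many limits are used, at the dense prices and the integer levels, so one null set
serves all `ε` and all prices. -/
theorem ae_eventually_avg_close {Ω : Type*} [MeasurableSpace Ω] {Pr : Measure Ω}
    (hμ : ∀ a, Integrable (fun x : A → ℝ => x a) μ) {ζ : ℕ → Ω → A → ℝ}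
    (hlaw : ∀ b, HasLaw (ζ b) μ Pr) (hind : iIndepFun ζ Pr) :
    ∀ᵐ ω ∂Pr, ∀ ε : ℝ, 0 < ε → ∀ᶠ n in atTop, ∀ v : A → ℝ,
      |avg (fun b => ζ b ω) n (fun z => minCost fun a => v a - z a) - surplus μ v| ≤ ε := by
  have h1 := ae_all_iff.2 fun k => ae_tendsto_avg hlaw hind
    (continuous_minCost_sub (TopologicalSpace.denseSeq (A → ℝ) k)).measurable
    (integrable_minCost hμ _)
  have h2 := ae_all_iff.2 fun M : ℕ => ae_tendsto_avg hlaw hind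
    (continuous_excess (A := A) (M : ℝ)).measurable (integrable_excess hμ (Nat.cast_nonneg M))
  filter_upwards [h1, h2] with ω h1 h2 ε hε
  exact eventually_avg_close hμ _ h1 h2 hε

end UniformLaw

/-! ### Fluid approximation of one group -/

section Group

variable {A : Type*} [Fintype A] [Nonempty A] {μ : Measure (A → ℝ)} [IsProbabilityMeasure μ]

omit [Nonempty A] in
theorem div_mem_stdSimplex {N : ℕ} (hN : N ≠ 0) {y : A → ℝ} (hy : ∀ a, 0 ≤ y a)
    (hsum : ∑ a, y a = N) : (fun a => y a / N) ∈ stdSimplex ℝ A := by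
  refine ⟨fun a => div_nonneg (hy a) (Nat.cast_nonneg N), ?_⟩
  rw [← Finset.sum_div, hsum, div_self (by exact_mod_cast hN)]

theorem dualObj_eq_avg {c : ℕ → A → ℝ} {C : A → ℝ} {x : ℕ → A → ℝ}
    (hc : ∀ b a, c b a = C a - x b a) {N : ℕ} (hN : N ≠ 0) (y : A → ℕ) (v : A → ℝ) :
    dualObj c N y v = ∑ a, C a * (y a : ℝ) +
      N * (avg x N (fun z => minCost fun a => C a + v a - z a) -
        ∑ a, (C a + v a) * ((y a : ℝ) / N)) := by
  have hN' : (N : ℝ) ≠ 0 := by exact_mod_cast hN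
  have h1 : N * avg x N (fun z => minCost fun a => C a + v a - z a) =
      ∑ b : Fin N, minCost (fun a => c b a + v a) := by
    rw [avg, mul_div_cancel₀ _ hN', ← Fin.sum_univ_eq_sum_range
      (fun b => minCost fun a => C a + v a - x b a)]
    refine Finset.sum_congr rfl fun b _ => ?_
    congr 1
    ext a
    rw [hc]
    ring
  have h2 : N * ∑ a, (C a + v a) * ((y a : ℝ) / N) =
      ∑ a, C a * (y a : ℝ) + ∑ a, v a * (y a : ℝ) := by
    rw [Finset.mul_sum, ← Finset.sum_add_distrib]
    refine Finset.sum_congr rfl fun a _ => ?_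
    field_simp
  rw [mul_sub, h1, h2, dualObj]
  ring

/-- A uniform error between two families passes to their extrema: weak duality at every price bounds
`subValue` from below, and an optimal price bounds it from above. -/
theorem abs_subValue_sub_fluidValue_le (hμ : ∀ a, Integrable (fun x : A → ℝ => x a) μ)
    {c : ℕ → A → ℝ} {C : A → ℝ} {x : ℕ → A → ℝ} (hc : ∀ b a, c b a = C a - x b a) {N : ℕ}
    (hN : N ≠ 0) {ε : ℝ}
    (h : ∀ v : A → ℝ, |avg x N (fun z => minCost fun a => v a - z a) - surplus μ v| ≤ ε)
    {y : A → ℕ} (hy : ∑ a, y a = N) :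
    |subValue c N y - fluidValue C μ N (fun a => (y a : ℝ))| ≤ ε * N := by
  have hNpos : (0 : ℝ) < N := by exact_mod_cast Nat.pos_of_ne_zero hN
  have hP : (fun a => (y a : ℝ) / N) ∈ stdSimplex ℝ A :=
    div_mem_stdSimplex hN (fun a => Nat.cast_nonneg (y a)) (by exact_mod_cast hy)
  rw [fluidValue, scaledEntropy, abs_le]
  constructor
  · have h1 : (∑ a, C a * (y a : ℝ) - subValue c N y) / N - ε ≤
        entropy μ fun a => (y a : ℝ) / N := by
      refine le_ciInf fun u => ?_
      have h2 := dualObj_le_subValue c hy fun a => u a - C a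
      rw [dualObj_eq_avg hc hN] at h2
      simp only [add_sub_cancel] at h2
      have h3 := (abs_le.1 (h u)).1
      rw [sub_le_iff_le_add, div_le_iff₀ hNpos]
      have h4 := mul_le_mul_of_nonneg_left h3 hNpos.le
      linarith
    have h5 := mul_le_mul_of_nonneg_left h1 hNpos.le
    rw [mul_sub, mul_div_cancel₀ _ hNpos.ne'] at h5
    linarith
  · obtain ⟨v, hv⟩ := exists_subValue_eq_dualObj c hy
    rw [hv, dualObj_eq_avg hc hN]
    have h1 := mul_le_mul_of_nonneg_left (entropy_le hμ hP fun a => C a + v a) hNpos.le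
    have h2 := mul_le_mul_of_nonneg_left (abs_le.1 (h fun a => C a + v a)).2 hNpos.le
    linarith

/-- The value per agent depends only on the shares `y / N` and is uniformly continuous on the
compact simplex; hence one `δ` for all `N`. -/
theorem exists_fluidValue_close (hμ : ∀ a, Integrable (fun x : A → ℝ => x a) μ) (C : A → ℝ)
    {ε : ℝ} (hε : 0 < ε) :
    ∃ δ > 0, ∀ (N : ℕ) (y z : A → ℝ), (∀ a, 0 ≤ y a) → ∑ a, y a = N → (∀ a, 0 ≤ z a) →
      ∑ a, z a = N → (∀ a, |y a - z a| ≤ δ * N) →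
      |fluidValue C μ N y - fluidValue C μ N z| ≤ ε * N := by
  have hcont : ContinuousOn (fun P : A → ℝ => ∑ a, C a * P a - entropy μ P) (stdSimplex ℝ A) :=
    ContinuousOn.sub (by fun_prop) (continuousOn_entropy hμ)
  obtain ⟨δ, hδ, h⟩ := Metric.uniformContinuousOn_iff_le.1
    ((isCompact_stdSimplex ℝ A).uniformContinuousOn_of_continuous hcont) ε hε
  refine ⟨δ, hδ, fun N y z hy hys hz hzs hyz => ?_⟩
  rcases eq_or_ne N 0 with rfl | hN
  · have : y = z := by
      ext a
      have := hyz a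
      simp only [Nat.cast_zero, mul_zero] at this
      exact sub_eq_zero.1 (abs_nonpos_iff.1 this)
    simp [this]
  have hNpos : (0 : ℝ) < N := by exact_mod_cast Nat.pos_of_ne_zero hN
  have h1 := h _ (div_mem_stdSimplex hN hy hys) _ (div_mem_stdSimplex hN hz hzs)
    ((dist_pi_le_iff hδ.le).2 fun a => by
      rw [Real.dist_eq, ← sub_div, abs_div, abs_of_pos hNpos, div_le_iff₀ hNpos]
      exact hyz a)
  have h2 : ∀ y : A → ℝ, fluidValue C μ N y =
      N * (∑ a, C a * (y a / N) - entropy μ fun a => y a / N) := by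
    intro y
    rw [fluidValue, scaledEntropy, mul_sub, Finset.mul_sum]
    congr 1
    refine Finset.sum_congr rfl fun a _ => ?_
    field_simp
  rw [h2, h2, ← mul_sub, abs_mul, abs_of_pos hNpos, mul_comm]
  rw [Real.dist_eq] at h1
  exact mul_le_mul_of_nonneg_right h1 hNpos.le

theorem continuousOn_fluidValue (hμ : ∀ a, Integrable (fun x : A → ℝ => x a) μ) (C : A → ℝ)
    (N : ℕ) : ContinuousOn (fluidValue C μ N) {y | (∀ a, 0 ≤ y a) ∧ ∑ a, y a = N} := by
  rcases eq_or_ne N 0 with rfl | hN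
  -- In an empty group the shares `y / 0` are junk, but the factor `N = 0` removes the entropy term.
  · have : fluidValue C μ 0 = fun y => ∑ a, C a * y a := by
      ext y
      simp [fluidValue, scaledEntropy]
    rw [this]
    fun_prop
  · refine ContinuousOn.sub (by fun_prop) (continuousOn_const.mul ?_)
    exact (continuousOn_entropy hμ).comp (by fun_prop) fun y hy =>
      div_mem_stdSimplex hN hy.1 hy.2

theorem fluidValue_convex_comb_le (hμ : ∀ a, Integrable (fun x : A → ℝ => x a) μ) (C : A → ℝ)
    {N : ℕ} {y z : A → ℝ} (hy : ∀ a, 0 ≤ y a) (hys : ∑ a, y a = N) (hz : ∀ a, 0 ≤ z a)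
    (hzs : ∑ a, z a = N) {s t : ℝ} (hs : 0 ≤ s) (ht : 0 ≤ t) (hst : s + t = 1) :
    fluidValue C μ N (s • y + t • z) ≤ s * fluidValue C μ N y + t * fluidValue C μ N z := by
  have h1 : ∑ a, C a * (s • y + t • z) a = s * ∑ a, C a * y a + t * ∑ a, C a * z a := by
    rw [Finset.mul_sum, Finset.mul_sum, ← Finset.sum_add_distrib]
    refine Finset.sum_congr rfl fun a _ => ?_
    simp only [Pi.add_apply, Pi.smul_apply, smul_eq_mul]
    ring
  simp only [fluidValue, scaledEntropy]
  rw [h1]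
  rcases eq_or_ne N 0 with rfl | hN
  · simp
  have h2 := (concaveOn_entropy hμ).2 (div_mem_stdSimplex hN hy hys)
    (div_mem_stdSimplex hN hz hzs) hs ht hst
  have h3 : (s • (fun a => y a / (N : ℝ)) + t • fun a => z a / (N : ℝ)) =
      fun a => (s • y + t • z) a / (N : ℝ) := by
    ext a
    simp only [Pi.add_apply, Pi.smul_apply, smul_eq_mul]
    ring
  rw [h3] at h2
  simp only [smul_eq_mul] at h2
  have h4 := mul_le_mul_of_nonneg_left h2 (Nat.cast_nonneg (α := ℝ) N)
  linarith

end Group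

/-! ### Rounding within one group -/

section Rounding

variable {A : Type*} [Fintype A]

/-- Integer point with prescribed entries `k` on `A`, the remainder of `N` being put on `none`. -/
def fillNone (N : ℕ) (k : A → ℕ) : Option A → ℕ
  | none => N - ∑ a, k a
  | some a => k a

theorem sum_fillNone {N : ℕ} {k : A → ℕ} (h : ∑ a, k a ≤ N) : ∑ o, fillNone N k o = N := by
  rw [Fintype.sum_option]
  exact Nat.sub_add_cancel h

/-- Rounding the entries on `A` down by at most `L` moves every entry by at most `(|A| + 1) L`. -/
theorem fillNone_close {N : ℕ} {z : Option A → ℝ} (hz : ∀ o, 0 ≤ z o) (hzs : ∑ o, z o = N)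
    {k : A → ℕ} {L : ℝ} (hL : 0 ≤ L) (hle : ∀ a, (k a : ℝ) ≤ z (some a))
    (hge : ∀ a, z (some a) - L ≤ k a) :
    ∑ o, fillNone N k o = N ∧ ∀ o, |(fillNone N k o : ℝ) - z o| ≤ (Fintype.card A + 1) * L := by
  rw [Fintype.sum_option] at hzs
  have h1 : ∑ a, (k a : ℝ) ≤ ∑ a, z (some a) := Finset.sum_le_sum fun a _ => hle a
  have h2 : ∑ a, z (some a) ≤ ∑ a, ((k a : ℝ) + L) :=
    Finset.sum_le_sum fun a _ => by linarith [hge a]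
  rw [Finset.sum_add_distrib, Finset.sum_const, Finset.card_univ, nsmul_eq_mul] at h2
  have h3 : ∑ a, k a ≤ N := by
    have : ((∑ a, k a : ℕ) : ℝ) ≤ N := by push_cast; linarith [hz none]
    exact_mod_cast this
  have hc : (0 : ℝ) ≤ Fintype.card A * L := by positivity
  refine ⟨sum_fillNone h3, fun o => ?_⟩
  cases o with
  | none =>
    simp only [fillNone]
    rw [Nat.cast_sub h3, abs_le]
    push_cast
    constructor <;> linarith
  | some a =>
    simp only [fillNone]
    rw [abs_le]
    constructor <;> linarith [hle a, hge a]

end Rounding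

/-! ### Group sizes tending jointly to infinity -/

section Sizes

variable {J T W : Type*}

theorem tendsto_size_fst (j : J) : Tendsto (fun N : Sizes J T W => N.1 j) atTop atTop :=
  Monotone.tendsto_atTop_atTop (fun _ _ h => h.1 j) fun k => ⟨(fun _ => k, fun _ => k), le_rfl⟩

theorem tendsto_size_snd (g : T × W) : Tendsto (fun N : Sizes J T W => N.2 g) atTop atTop :=
  Monotone.tendsto_atTop_atTop (fun _ _ h => h.2 g) fun k => ⟨(fun _ => k, fun _ => k), le_rfl⟩

end Sizes

/-! ### Feasible plans, rounding and optimality in the market -/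

section Market

variable {J T W R : Type*} [Fintype J] [DecidableEq J] [Fintype T] [Fintype W] [Fintype R]
  (M : Market J T W R)

omit [Fintype J] in
theorem Market.convex_feasible (N : Sizes J T W) : Convex ℝ (M.feasible N) := by
  intro x hx y hy s t hs ht hst
  obtain ⟨hx1, hx2, hx3, hx4, hx5⟩ := hx
  obtain ⟨hy1, hy2, hy3, hy4, hy5⟩ := hy
  refine ⟨fun j o => ?_, fun g r => ?_, fun j o => ?_, fun j => ?_, fun g => ?_⟩ <;>
    simp only [Prod.fst_add, Prod.snd_add, Prod.smul_fst, Prod.smul_snd, Pi.add_apply,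
      Pi.smul_apply, smul_eq_mul]
  · exact add_nonneg (mul_nonneg hs (hx1 j o)) (mul_nonneg ht (hy1 j o))
  · exact add_nonneg (mul_nonneg hs (hx2 g r)) (mul_nonneg ht (hy2 g r))
  · refine (add_le_add (mul_le_mul_of_nonneg_left (hx3 j o) hs)
      (mul_le_mul_of_nonneg_left (hy3 j o) ht)).trans_eq ?_
    simp only [Finset.mul_sum, ← Finset.sum_add_distrib]
    exact Finset.sum_congr rfl fun w _ => Finset.sum_congr rfl fun r _ => by ring
  · rw [Finset.sum_add_distrib, ← Finset.mul_sum, ← Finset.mul_sum, hx4, hy4, ← add_mul, hst,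
      one_mul]
  · rw [Finset.sum_add_distrib, ← Finset.mul_sum, ← Finset.mul_sum, hx5, hy5, ← add_mul, hst,
      one_mul]

omit [Fintype J] in
theorem Market.isCompact_feasible (N : Sizes J T W) : IsCompact (M.feasible N) := by
  have hclosed : IsClosed (M.feasible N) := by
    have h : M.feasible N = (⋂ j, ⋂ t, {x : Plan J T W R ℝ | 0 ≤ x.1 j t}) ∩ (⋂ g, ⋂ r, {x : Plan J T W R ℝ | 0 ≤ x.2 g r}) ∩
        (⋂ j, ⋂ t, {x : Plan J T W R ℝ | x.1 j (some t) ≤ ∑ w, ∑ r, (M.delta r j : ℝ) * x.2 (t, w) (some r)}) ∩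
        (⋂ j, {x : Plan J T W R ℝ | ∑ t, x.1 j t = N.1 j}) ∩
          ⋂ g, {x : Plan J T W R ℝ | ∑ r, x.2 g r = N.2 g} := by
      ext x
      simp only [Market.feasible, Set.mem_ofPred_eq, Set.mem_inter_iff, Set.mem_iInter, and_assoc]
    rw [h]
    refine IsClosed.inter (IsClosed.inter (IsClosed.inter (IsClosed.inter ?_ ?_) ?_) ?_) ?_
    · exact isClosed_iInter fun j => isClosed_iInter fun t =>
        isClosed_le (by fun_prop) (by fun_prop)
    · exact isClosed_iInter fun j => isClosed_iInter fun t =>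
        isClosed_le (by fun_prop) (by fun_prop)
    · exact isClosed_iInter fun j => isClosed_iInter fun t =>
        isClosed_le (by fun_prop) (by fun_prop)
    · exact isClosed_iInter fun j => isClosed_eq (by fun_prop) (by fun_prop)
    · exact isClosed_iInter fun j => isClosed_eq (by fun_prop) (by fun_prop)
  refine (isCompact_Icc (a := (0 : Plan J T W R ℝ))
    (b := (fun j _ => (N.1 j : ℝ), fun g _ => (N.2 g : ℝ)))).of_isClosed_subset hclosed ?_
  intro x hx
  refine ⟨⟨fun j t => hx.1 j t, fun g r => hx.2.1 g r⟩, ⟨fun j t => ?_, fun g r => ?_⟩⟩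
  · exact (Finset.single_le_sum (f := fun t => x.1 j t) (fun t _ => hx.1 j t)
      (Finset.mem_univ t)).trans_eq (hx.2.2.2.1 j)
  · exact (Finset.single_le_sum (f := fun r => x.2 g r) (fun r _ => hx.2.1 g r)
      (Finset.mem_univ r)).trans_eq (hx.2.2.2.2 g)

omit [Fintype J] in
-- With everyone opting out, no supply is required, so both problems have a feasible point for all
-- group sizes.
theorem Market.optOut_mem_masterFeasible (N : Sizes J T W) :
    ((fun j => fillNone (N.1 j) fun _ => 0, fun g => fillNone (N.2 g) fun _ => 0) :
      Plan J T W R ℕ) ∈ M.masterFeasible N := by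
  refine ⟨fun _ _ => Nat.cast_nonneg _, fun _ _ => Nat.cast_nonneg _, fun j t => ?_,
    fun j => ?_, fun g => ?_⟩
  · simp [Plan.toReal, fillNone]
  · have := sum_fillNone (A := T) (N := N.1 j) (k := fun _ => 0) (by simp)
    simp only [Plan.toReal]
    exact_mod_cast this
  · have := sum_fillNone (A := R) (N := N.2 g) (k := fun _ => 0) (by simp)
    simp only [Plan.toReal]
    exact_mod_cast this

omit [Fintype J] in
theorem Market.masterFeasible_sum {N : Sizes J T W} {x : Plan J T W R ℕ}
    (hx : x ∈ M.masterFeasible N) :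
    (∀ j, ∑ t, x.1 j t = N.1 j) ∧ ∀ g, ∑ r, x.2 g r = N.2 g := by
  obtain ⟨-, -, -, h4, h5⟩ := hx
  simp only [Plan.toReal] at h4 h5
  exact ⟨fun j => by exact_mod_cast h4 j, fun g => by exact_mod_cast h5 g⟩

theorem Market.finite_masterFeasible (N : Sizes J T W) : (M.masterFeasible N).Finite := by
  classical
  refine (Set.finite_Icc (0 : Plan J T W R ℕ) (fun j _ => N.1 j, fun g _ => N.2 g)).subset ?_
  intro x hx
  obtain ⟨h4, h5⟩ := M.masterFeasible_sum hx
  refine ⟨⟨fun _ _ => Nat.zero_le _, fun _ _ => Nat.zero_le _⟩, ⟨fun j t => ?_, fun g r => ?_⟩⟩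
  · exact (Finset.single_le_sum (f := fun t => x.1 j t) (fun _ _ => Nat.zero_le _)
      (Finset.mem_univ t)).trans_eq (h4 j)
  · exact (Finset.single_le_sum (f := fun r => x.2 g r) (fun _ _ => Nat.zero_le _)
      (Finset.mem_univ r)).trans_eq (h5 g)

theorem Market.exists_isOptimal_master (F : Plan J T W R ℕ → ℝ) (N : Sizes J T W) :
    ∃ x, IsOptimal F (M.masterFeasible N) x := by
  obtain ⟨x, hx, h⟩ := Set.exists_min_image _ F (M.finite_masterFeasible N)
    ⟨_, M.optOut_mem_masterFeasible N⟩
  exact ⟨x, hx, h⟩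

/-- Upper bound on the supply of tasks of type `j` lost by rounding down in one time window. -/
def Market.roundingLoss (j : J) : ℕ := ∑ _w : W, ∑ r, M.delta r j

omit [Fintype J] in
/-- Every feasible point has a feasible integer point within bounded distance. -/
theorem Market.exists_masterFeasible_close {N : Sizes J T W} {x : Plan J T W R ℝ}
    (hx : x ∈ M.feasible N) :
    ∃ x' ∈ M.masterFeasible N,
      (∀ j t, |(x'.1 j t : ℝ) - x.1 j t| ≤ (Fintype.card T + 1) * (M.roundingLoss j + 1)) ∧
      ∀ g r, |(x'.2 g r : ℝ) - x.2 g r| ≤ Fintype.card R + 1 := by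
  obtain ⟨h1, h2, h3, h4, h5⟩ := hx
  -- Flooring driver entries destroys at most `M.roundingLoss j` units of supply per window, so
  -- permits are lowered by that amount before being floored; the extra 1 in `L` is the floor's own
  -- error.
  have hy := fun j => fillNone_close (h1 j) (h4 j)
    (k := fun t => ⌊x.1 j (some t) - M.roundingLoss j⌋₊) (L := M.roundingLoss j + 1)
    (by positivity)
    (fun t => by
      refine (Nat.cast_le.2 (Nat.floor_mono (sub_le_self _ (Nat.cast_nonneg _)))).trans
        (Nat.floor_le (h1 j (some t))))
    (fun t => by linarith [Nat.lt_floor_add_one (x.1 j (some t) - M.roundingLoss j)])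
  have hf := fun g => fillNone_close (h2 g) (h5 g) (k := fun r => ⌊x.2 g (some r)⌋₊) (L := 1)
    zero_le_one (fun r => Nat.floor_le (h2 g (some r)))
    (fun r => by linarith [Nat.lt_floor_add_one (x.2 g (some r))])
  refine ⟨(fun j => fillNone (N.1 j) fun t => ⌊x.1 j (some t) - M.roundingLoss j⌋₊,
    fun g => fillNone (N.2 g) fun r => ⌊x.2 g (some r)⌋₊),
    ⟨fun _ _ => Nat.cast_nonneg _, fun _ _ => Nat.cast_nonneg _, fun j t => ?_,
      fun j => ?_, fun g => ?_⟩, fun j => (hy j).2, fun g r => ?_⟩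
  · simp only [Plan.toReal, fillNone]
    -- If the lowered permit is nonpositive, its natural floor is 0 and needs no supply.
    rcases le_total (x.1 j (some t) - M.roundingLoss j) 0 with h | h
    · rw [Nat.floor_of_nonpos h, Nat.cast_zero]
      positivity
    · refine (Nat.floor_le h).trans ?_
      refine (sub_le_sub_right (h3 j t) _).trans ?_
      rw [sub_le_iff_le_add, Market.roundingLoss]
      push_cast
      rw [← Finset.sum_add_distrib]
      refine Finset.sum_le_sum fun w _ => ?_
      rw [← Finset.sum_add_distrib]
      refine Finset.sum_le_sum fun r _ => ?_
      have := mul_le_mul_of_nonneg_left (Nat.lt_floor_add_one (x.2 (t, w) (some r))).le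
        (Nat.cast_nonneg (α := ℝ) (M.delta r j))
      linarith
  · have := (hy j).1
    simp only [Plan.toReal]
    exact_mod_cast this
  · have := (hf g).1
    simp only [Plan.toReal]
    exact_mod_cast this
  · simpa using (hf g).2 r

omit [DecidableEq J] in
/-- Termwise bounds proportional to the group sizes add up to a bound on the total. -/
theorem abs_sum_sub_sum_le (N : Sizes J T W) {ε : ℝ} {a a' : J → ℝ} {b b' : T × W → ℝ}
    (ha : ∀ j, |a j - a' j| ≤ ε * N.1 j) (hb : ∀ g, |b g - b' g| ≤ ε * N.2 g) :
    |(∑ j, a j + ∑ t, ∑ w, b (t, w)) - (∑ j, a' j + ∑ t, ∑ w, b' (t, w))| ≤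
      ε * totalSize N := by
  have h : (∑ j, a j + ∑ t, ∑ w, b (t, w)) - (∑ j, a' j + ∑ t, ∑ w, b' (t, w)) =
      ∑ j, (a j - a' j) + ∑ g, (b g - b' g) := by
    rw [← Fintype.sum_prod_type (f := b), ← Fintype.sum_prod_type (f := b'),
      Finset.sum_sub_distrib, Finset.sum_sub_distrib]
    ring
  rw [h, totalSize]
  push_cast
  rw [mul_add, Finset.mul_sum, Finset.mul_sum]
  exact (abs_add_le _ _).trans (add_le_add
    ((Finset.abs_sum_le_sum_abs _ _).trans (Finset.sum_le_sum fun j _ => ha j))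
    ((Finset.abs_sum_le_sum_abs _ _).trans (Finset.sum_le_sum fun g _ => hb g)))

variable [∀ j, IsProbabilityMeasure (M.lawS j)] [∀ g, IsProbabilityMeasure (M.lawD g)]
  (hS : ∀ j t, Integrable (fun x : Option T → ℝ => x t) (M.lawS j))
  (hD : ∀ g r, Integrable (fun x : Option R → ℝ => x r) (M.lawD g))

include hS hD

theorem Market.convexOn_fluidObj (N : Sizes J T W) :
    ConvexOn ℝ (M.feasible N) (M.fluidObj N) := by
  refine ⟨M.convex_feasible N, ?_⟩
  rintro x ⟨hx1, hx2, -, hx4, hx5⟩ y ⟨hy1, hy2, -, hy4, hy5⟩ s t hs ht hst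
  have h1 : ∑ j, fluidValue (M.CS j) (M.lawS j) (N.1 j) ((s • x + t • y).1 j) ≤
      ∑ j, (s * fluidValue (M.CS j) (M.lawS j) (N.1 j) (x.1 j) +
        t * fluidValue (M.CS j) (M.lawS j) (N.1 j) (y.1 j)) :=
    Finset.sum_le_sum fun j _ => fluidValue_convex_comb_le (hS j) (M.CS j) (hx1 j) (hx4 j)
      (hy1 j) (hy4 j) hs ht hst
  have h2 : ∑ o, ∑ w, fluidValue (M.CD (o, w)) (M.lawD (o, w)) (N.2 (o, w))
      ((s • x + t • y).2 (o, w)) ≤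
      ∑ o, ∑ w, (s * fluidValue (M.CD (o, w)) (M.lawD (o, w)) (N.2 (o, w)) (x.2 (o, w)) +
        t * fluidValue (M.CD (o, w)) (M.lawD (o, w)) (N.2 (o, w)) (y.2 (o, w))) :=
    Finset.sum_le_sum fun o _ => Finset.sum_le_sum fun w _ =>
      fluidValue_convex_comb_le (hD (o, w)) (M.CD (o, w)) (hx2 _) (hx5 _)
        (hy2 _) (hy5 _) hs ht hst
  simp only [Finset.sum_add_distrib, ← Finset.mul_sum] at h1 h2
  simp only [Market.fluidObj, smul_eq_mul]
  linarith

theorem Market.exists_isOptimal_fluid (N : Sizes J T W) :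
    ∃ x, IsOptimal (M.fluidObj N) (M.feasible N) x := by
  have hcont : ContinuousOn (M.fluidObj N) (M.feasible N) := by
    refine ContinuousOn.add (continuousOn_finsetSum _ fun j _ => ?_)
      (continuousOn_finsetSum _ fun t _ => continuousOn_finsetSum _ fun w _ => ?_)
    · exact (continuousOn_fluidValue (hS j) (M.CS j) (N.1 j)).comp
        (f := fun x : Plan J T W R ℝ => x.1 j) (by fun_prop) fun x hx => ⟨hx.1 j, hx.2.2.2.1 j⟩
    · exact (continuousOn_fluidValue (hD (t, w)) (M.CD (t, w)) (N.2 (t, w))).comp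
        (f := fun x : Plan J T W R ℝ => x.2 (t, w)) (by fun_prop)
        fun x hx => ⟨hx.2.1 _, hx.2.2.2.2 _⟩
  obtain ⟨x, hx, h⟩ := (M.isCompact_feasible N).exists_isMinOn
    ⟨_, M.optOut_mem_masterFeasible N⟩ hcont
  exact ⟨x, hx, fun x' hx' => h hx'⟩

/-- In large markets every feasible point is close, also in value, to a feasible integer point. -/
theorem Market.eventually_exists_close {ε : ℝ} (hε : 0 < ε) :
    ∀ᶠ N : Sizes J T W in atTop, ∀ x ∈ M.feasible N, ∃ x' ∈ M.masterFeasible N,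
      (∀ j t, |(x'.1 j t : ℝ) - x.1 j t| ≤ ε * N.1 j) ∧
      (∀ g r, |(x'.2 g r : ℝ) - x.2 g r| ≤ ε * N.2 g) ∧
      |M.fluidObj N (Plan.toReal x') - M.fluidObj N x| ≤ ε * totalSize N := by
  choose δS hδS hcS using fun j => exists_fluidValue_close (hS j) (M.CS j) hε
  choose δD hδD hcD using fun g => exists_fluidValue_close (hD g) (M.CD g) hε
  have large : ∀ K δ : ℝ, 0 < δ → ∀ᶠ n : ℕ in atTop, K ≤ δ * n := fun K δ hδ =>
    (tendsto_natCast_atTop_atTop.const_mul_atTop hδ).eventually_ge_atTop K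
  -- The rounding displacement is a constant; `min ε (δS j)` makes it small both as a displacement
  -- and for the continuity of the value.
  have hNS : ∀ᶠ N : Sizes J T W in atTop, ∀ j,
      (Fintype.card T + 1) * ((M.roundingLoss j : ℝ) + 1) ≤ min ε (δS j) * N.1 j :=
    eventually_all.2 fun j =>
      (tendsto_size_fst j).eventually
        (large _ _ (lt_min hε (hδS j)))
  have hND : ∀ᶠ N : Sizes J T W in atTop, ∀ g,
      (Fintype.card R + 1 : ℝ) ≤ min ε (δD g) * N.2 g :=
    eventually_all.2 fun g =>
      (tendsto_size_snd g).eventually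
        (large _ _ (lt_min hε (hδD g)))
  filter_upwards [hNS, hND] with N hNS hND x hx
  obtain ⟨x', hx', h1, h2⟩ := M.exists_masterFeasible_close hx
  have h1' : ∀ j t, |(x'.1 j t : ℝ) - x.1 j t| ≤ min ε (δS j) * N.1 j := fun j t =>
    (h1 j t).trans (hNS j)
  have h2' : ∀ g r, |(x'.2 g r : ℝ) - x.2 g r| ≤ min ε (δD g) * N.2 g := fun g r =>
    (h2 g r).trans (hND g)
  refine ⟨x', hx', fun j t => (h1' j t).trans ?_, fun g r => (h2' g r).trans ?_,
    abs_sum_sub_sum_le N (fun j => ?_)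
      (b := fun g => fluidValue (M.CD g) (M.lawD g) (N.2 g) ((Plan.toReal x').2 g))
      (b' := fun g => fluidValue (M.CD g) (M.lawD g) (N.2 g) (x.2 g)) fun g => ?_⟩
  · exact mul_le_mul_of_nonneg_right (min_le_left _ _) (Nat.cast_nonneg _)
  · exact mul_le_mul_of_nonneg_right (min_le_left _ _) (Nat.cast_nonneg _)
  · exact hcS j (N.1 j) _ _ (hx'.1 j) (hx'.2.2.2.1 j) (hx.1 j) (hx.2.2.2.1 j) fun t =>
      (h1' j t).trans (mul_le_mul_of_nonneg_right (min_le_right _ _) (Nat.cast_nonneg _))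
  · exact hcD g (N.2 g) _ _ (hx'.2.1 g) (hx'.2.2.2.2 g) (hx.2.1 g) (hx.2.2.2.2 g) fun r =>
      (h2' g r).trans (mul_le_mul_of_nonneg_right (min_le_right _ _) (Nat.cast_nonneg _))

end Market

end CSD

/-! ### The main theorem -/

theorem proposition2 {J T W R : Type*} [Fintype J] [DecidableEq J] [Fintype T] [Fintype W]
    [Fintype R] (M : CSD.Market J T W R)
    {Ω : Type*} [MeasurableSpace Ω] (Pr : Measure Ω) [IsProbabilityMeasure Pr]
    -- random utilities of the `b`-th shipper of group `j` and of the `a`-th driver of group `g`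
    (ζ : J → ℕ → Ω → Option T → ℝ) (ξ : T × W → ℕ → Ω → Option R → ℝ)
    (hζ_law : ∀ j b, HasLaw (ζ j b) (M.lawS j) Pr) (hζ_indep : ∀ j, iIndepFun (ζ j) Pr)
    (hξ_law : ∀ g a, HasLaw (ξ g a) (M.lawD g) Pr) (hξ_indep : ∀ g, iIndepFun (ξ g) Pr)
    (hζ_mean : ∀ j t, Integrable (fun x : Option T → ℝ => x t) (M.lawS j))
    (hξ_mean : ∀ g r, Integrable (fun x : Option R → ℝ => x r) (M.lawD g))
    -- perceived costs
    (cS : Ω → J → ℕ → Option T → ℝ) (hcS : ∀ ω j b t, cS ω j b t = M.CS j t - ζ j b ω t)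
    (cD : Ω → T × W → ℕ → Option R → ℝ) (hcD : ∀ ω g a r, cD ω g a r = M.CD g r - ξ g a ω r) :
    -- the perturbation functions are finite exactly on the probability simplices
    (∀ j (P : Option T → ℝ),
      BddBelow (Set.range fun v : Option T → ℝ => ∑ t, v t * P t - CSD.surplus (M.lawS j) v) ↔
        P ∈ stdSimplex ℝ (Option T)) ∧
    (∀ g (P : Option R → ℝ),
      BddBelow (Set.range fun v : Option R → ℝ => ∑ r, v r * P r - CSD.surplus (M.lawD g) v) ↔
        P ∈ stdSimplex ℝ (Option R)) ∧
    -- the approximate master problem is convex, and both problems have solutions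
    (∀ N : CSD.Sizes J T W,
      ConvexOn ℝ (M.feasible N) (M.fluidObj N) ∧
      (∃ x, CSD.IsOptimal (M.fluidObj N) (M.feasible N) x) ∧
      ∀ ω, ∃ x, CSD.IsOptimal (CSD.masterObj (cS ω) (cD ω) N) (M.masterFeasible N) x) ∧
    -- approximation as all the group sizes grow, at whatever rates
    ∀ᵐ ω ∂Pr, ∀ ε : ℝ, 0 < ε → ∀ᶠ N : CSD.Sizes J T W in atTop,
      -- optimal values of the shippers' and drivers' sub-problems
      (∀ j (y : Option T → ℕ), ∑ t, y t = N.1 j →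
        |CSD.subValue (cS ω j) (N.1 j) y -
          CSD.fluidValue (M.CS j) (M.lawS j) (N.1 j) (fun t => (y t : ℝ))| ≤ ε * N.1 j) ∧
      (∀ g (f : Option R → ℕ), ∑ r, f r = N.2 g →
        |CSD.subValue (cD ω g) (N.2 g) f -
          CSD.fluidValue (M.CD g) (M.lawD g) (N.2 g) (fun r => (f r : ℝ))| ≤ ε * N.2 g) ∧
      -- objectives, uniformly over the feasible set of the master problem
      (∀ x ∈ M.masterFeasible N,
        |CSD.masterObj (cS ω) (cD ω) N x - M.fluidObj N (CSD.Plan.toReal x)| ≤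
          ε * CSD.totalSize N) ∧
      -- every feasible point of the approximate problem is close to one of the master problem
      (∀ x ∈ M.feasible N, ∃ x' ∈ M.masterFeasible N,
        (∀ j t, |(x'.1 j t : ℝ) - x.1 j t| ≤ ε * N.1 j) ∧
        (∀ g r, |(x'.2 g r : ℝ) - x.2 g r| ≤ ε * N.2 g) ∧
        |CSD.masterObj (cS ω) (cD ω) N x' - M.fluidObj N x| ≤ ε * CSD.totalSize N) ∧
      -- optimal values of the two problems, and near-optimality of the solutions
      (∀ x x', CSD.IsOptimal (CSD.masterObj (cS ω) (cD ω) N) (M.masterFeasible N) x →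
        CSD.IsOptimal (M.fluidObj N) (M.feasible N) x' →
        |CSD.masterObj (cS ω) (cD ω) N x - M.fluidObj N x'| ≤ ε * CSD.totalSize N ∧
        M.fluidObj N (CSD.Plan.toReal x) ≤ M.fluidObj N x' + ε * CSD.totalSize N) := by
  have hpS : ∀ j, IsProbabilityMeasure (M.lawS j) := fun j =>
    (hζ_law j 0).isProbabilityMeasure_iff.1 inferInstance
  have hpD : ∀ g, IsProbabilityMeasure (M.lawD g) := fun g =>
    (hξ_law g 0).isProbabilityMeasure_iff.1 inferInstance
  refine ⟨fun j P => CSD.bddBelow_conjugate_iff (hζ_mean j) P,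
    fun g P => CSD.bddBelow_conjugate_iff (hξ_mean g) P,
    fun N => ⟨M.convexOn_fluidObj hζ_mean hξ_mean N, M.exists_isOptimal_fluid hζ_mean hξ_mean N,
      fun ω => M.exists_isOptimal_master _ N⟩, ?_⟩
  have haeS := ae_all_iff.2 fun j =>
    CSD.ae_eventually_avg_close (hζ_mean j) (hζ_law j) (hζ_indep j)
  have haeD := ae_all_iff.2 fun g =>
    CSD.ae_eventually_avg_close (hξ_mean g) (hξ_law g) (hξ_indep g)
  filter_upwards [haeS, haeD] with ω hωS hωD ε hε
  -- Near-optimality at the end chains three errors: fluid against master at `x`, master against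
  -- fluid at the rounded point, and the rounding itself.
  have hε3 : 0 < ε / 3 := by positivity
  have hNS : ∀ᶠ N : CSD.Sizes J T W in atTop, ∀ j (y : Option T → ℕ), ∑ t, y t = N.1 j →
      |CSD.subValue (cS ω j) (N.1 j) y -
        CSD.fluidValue (M.CS j) (M.lawS j) (N.1 j) (fun t => (y t : ℝ))| ≤ ε / 3 * N.1 j :=
    eventually_all.2 fun j =>
      (CSD.tendsto_size_fst j).eventually
        (p := fun n : ℕ => ∀ y : Option T → ℕ, ∑ t, y t = n → |CSD.subValue (cS ω j) n y -
          CSD.fluidValue (M.CS j) (M.lawS j) n (fun t => (y t : ℝ))| ≤ ε / 3 * n)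
        (((hωS j (ε / 3) hε3).and (eventually_ne_atTop 0)).mono fun _ hn _ hy =>
          CSD.abs_subValue_sub_fluidValue_le (hζ_mean j) (hcS ω j) hn.2 hn.1 hy)
  have hND : ∀ᶠ N : CSD.Sizes J T W in atTop, ∀ g (f : Option R → ℕ), ∑ r, f r = N.2 g →
      |CSD.subValue (cD ω g) (N.2 g) f -
        CSD.fluidValue (M.CD g) (M.lawD g) (N.2 g) (fun r => (f r : ℝ))| ≤ ε / 3 * N.2 g :=
    eventually_all.2 fun g =>
      (CSD.tendsto_size_snd g).eventually
        (p := fun n : ℕ => ∀ f : Option R → ℕ, ∑ r, f r = n → |CSD.subValue (cD ω g) n f -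
          CSD.fluidValue (M.CD g) (M.lawD g) n (fun r => (f r : ℝ))| ≤ ε / 3 * n)
        (((hωD g (ε / 3) hε3).and (eventually_ne_atTop 0)).mono fun _ hn _ hf =>
          CSD.abs_subValue_sub_fluidValue_le (hξ_mean g) (hcD ω g) hn.2 hn.1 hf)
  filter_upwards [hNS, hND, M.eventually_exists_close hζ_mean hξ_mean hε3] with N hNS hND hclose
  have third : ∀ n : ℕ, ε / 3 * n ≤ ε * n := fun n =>
    mul_le_mul_of_nonneg_right (by linarith) (Nat.cast_nonneg n)
  have hobj : ∀ x ∈ M.masterFeasible N,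
      |CSD.masterObj (cS ω) (cD ω) N x - M.fluidObj N (CSD.Plan.toReal x)| ≤
        ε / 3 * CSD.totalSize N := fun x hx =>
    CSD.abs_sum_sub_sum_le N (fun j => hNS j _ ((M.masterFeasible_sum hx).1 j))
      (b := fun g => CSD.subValue (cD ω g) (N.2 g) (x.2 g))
      (b' := fun g => CSD.fluidValue (M.CD g) (M.lawD g) (N.2 g) ((CSD.Plan.toReal x).2 g))
      fun g => hND g _ ((M.masterFeasible_sum hx).2 g)
  have happrox : ∀ x ∈ M.feasible N, ∃ x' ∈ M.masterFeasible N,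
      (∀ j t, |(x'.1 j t : ℝ) - x.1 j t| ≤ ε * N.1 j) ∧
      (∀ g r, |(x'.2 g r : ℝ) - x.2 g r| ≤ ε * N.2 g) ∧
      |CSD.masterObj (cS ω) (cD ω) N x' - M.fluidObj N x| ≤ ε * CSD.totalSize N := by
    intro x hx
    obtain ⟨x', hx', h1, h2, h3⟩ := hclose x hx
    refine ⟨x', hx', fun j t => (h1 j t).trans (third _), fun g r => (h2 g r).trans (third _), ?_⟩
    have h4 := abs_sub_le (CSD.masterObj (cS ω) (cD ω) N x')
      (M.fluidObj N (CSD.Plan.toReal x')) (M.fluidObj N x)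
    have h5 : 0 ≤ ε * (CSD.totalSize N : ℝ) := by positivity
    linarith [hobj x' hx']
  refine ⟨fun j y hy => (hNS j y hy).trans (third _), fun g f hf => (hND g f hf).trans (third _),
    fun x hx => (hobj x hx).trans (third _), happrox, ?_⟩
  rintro x x' ⟨hx, hxopt⟩ ⟨hx', hxopt'⟩
  -- The rounded fluid optimum `x₁` competes with `x` in the master problem, and `x` competes with
  -- `x'` in the fluid problem.
  obtain ⟨x₁, hx₁, -, -, h₁⟩ := hclose x' hx'
  have h2 := abs_le.1 (hobj x hx)
  have h3 := abs_le.1 (hobj x₁ hx₁)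
  have h4 := abs_le.1 h₁
  have h5 := hxopt x₁ hx₁
  have h6 := hxopt' _ hx
  have h7 : 0 ≤ ε * (CSD.totalSize N : ℝ) := by positivity
  rw [abs_le]
  refine ⟨⟨?_, ?_⟩, ?_⟩ <;> linarith [h2.1, h2.2, h3.1, h3.2, h4.1, h4.2]
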